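/- **Setting.** Let $N,n\ge 0$ be integers and $\lambda=(\lambda_1,\dots,\lambda_N)\in\mathbb Z_{\ge0}^N$ with $\lambda_1+\dots+\lambda_N=n$. Let $\mathcal I_\lambda$ be the set of partitions $I=(I_1,\dots,I_N)$ of $\{1,\dots,n\}$ into disjoint subsets with $|I_k|=\lambda_k$. Let $T=(\mathbb C^\times)^n\times\mathbb C^\times$ act on the cotangent bundle $T^*\mathcal F_\lambda$ of the variety of flags $0=F_0\subset F_1\subset\dots\subset F_N=\mathbb C^n$ with $\dim F_i/F_{i-1}=\lambda_i$, the last factor acting on the fibres by multiplication. Its fixed points are the coordinate flags $x_I$, $I\in\mathcal I_\lambda$. The equivariant K-theory algebra with complex coefficients is given by its presentation $$K_T(T^*\mathcal F_\lambda)=\mathbb C[\Gamma^{\pm1}]^{S_\lambda}\otimes\mathbb C[z^{\pm1},h^{\pm1}]\,\big/\,\big\langle f(\Gamma)=f(z)\ :\ f\in\mathbb C[z^{\pm1}]^{S_n}\big\rangle ,$$ where $z=(z_1,\dots,z_n)$, $\Gamma$ is the set of the $n$ variables $\gamma_{i,j}$ ($1\le i\le N$, $1\le j\le\lambda_i$),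 and $S_\lambda=S_{\lambda_1}\times\dots\times S_{\lambda_N}$ permutes the $\gamma_{i,j}$ with the same $i$. Restriction to the fixed point $x_I$ is the algebra homomorphism $\kappa\mapsto\kappa|_{x_I}$ to $K_T(x_I)=\mathbb C[z^{\pm1},h^{\pm1}]$ that substitutes $\{\gamma_{k,1},\dots,\gamma_{k,\lambda_k}\}\mapsto\{z_a : a\in I_k\}$ for all $k$ and fixes $z$ and $h$. For $\sigma\in S_n$ and $I\in\mathcal I_\lambda$ put $$e^{\mathrm{vert}}_{\sigma,I,-}=\prod_{k<l}\ \prod_{\sigma(a)\in I_k}\ \prod_{\substack{\sigma(b)\in I_l\\ b<a}}\Big(1-\frac{h z_{\sigma(b)}}{z_{\sigma(a)}}\Big),\qquad e^{\mathrm{hor}}_{\sigma,I,-}=\prod_{k<l}\ \prod_{\sigma(a)\in I_k}\ \prod_{\substack{\sigma(b)\in I_l\\ b>a}}\Big(1-\frac{z_{\sigma(a)}}{z_{\sigma(b)}}\Big),$$ $$e_{\sigma,I}=e^{\mathrm{hor}}_{\sigma,I,-}\,e^{\mathrm{vert}}_{\sigma,I,-},\qquad P_{\sigma,I}=\prod_{k<l}\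 \prod_{\sigma(a)\in I_k}\ \prod_{\substack{\sigma(b)\in I_l\\ b>a}}\Big(-\frac{z_{\sigma(b)}}{z_{\sigma(a)}}\Big).$$ For $f\in\mathbb C[z^{\pm1},h^{\pm1}]$, regarded as a Laurent polynomial in $z$ with coefficients in $\mathbb C[h^{\pm1}]$, let $N(f)\subset\mathbb R^n$ be the convex hull of the exponents $m\in\mathbb Z^n$ for which the coefficient of $z^m$ is nonzero. Let $\phi_I:\mathbb R^n\to\mathbb R$ be the linear map with $\phi_I(\epsilon_a)=k$ if $a\in I_k$, where $\epsilon_1,\dots,\epsilon_n$ is the standard basis. Call $f$ *$I$-small* if $$\phi_I(N(f))\subset\Big[\,0,\ \sum_{1\le k<l\le N}\lambda_k\lambda_l\,(l-k)-1\Big].$$ **Theorem.** For every $\sigma\in S_n$ and $I\in\mathcal I_\lambda$ there exists a unique element $\kappa_{\sigma,I}\in K_T(T^*\mathcal F_\lambda)$ such that 1. (I) $\kappa_{\sigma,I}|_{x_J}$ is divisible by $e^{\mathrm{vert}}_{\sigma,J,-}$ in $\mathbb C[z^{\pm1},h^{\pm1}]$ for all $J\in\mathcal I_\lambda$; 2.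 (II) $\kappa_{\sigma,I}|_{x_I}=P_{\sigma,I}\,e_{\sigma,I}$; 3. (III) $\kappa_{\sigma,I}|_{x_J}$ is $J$-small for all $J\in\mathcal I_\lambda$ with $J\neq I$. -/

import Mathlib

open scoped TensorProduct LaurentPolynomial

noncomputable section

namespace EquivK

/-- The algebra `ℂ[x_i^{±1} : i ∈ ι]` of Laurent polynomials in the variables indexed by `ι`. -/
abbrev Laurent (ι : Type) : Type := AddMonoidAlgebra ℂ (ι → ℤ)

/-- Renaming the variables of a Laurent polynomial along a bijection `e`: the variable `x_i` is
sent to `x_{e i}`, so a monomial with exponents `m` is sent to the one with exponents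
`m ∘ e⁻¹`. -/
def rename {ι κ : Type} (e : ι ≃ κ) : Laurent ι →ₐ[ℂ] Laurent κ :=
  AddMonoidAlgebra.mapDomainAlgHom ℂ ℂ
    ({ toFun := fun m => m ∘ e.symm, map_zero' := rfl, map_add' := fun _ _ => rfl } :
      (ι → ℤ) →+ (κ → ℤ))

/-- The Laurent polynomials invariant under a group `G` of permutations of the variables. -/
def invariants {ι : Type} (G : Subgroup (Equiv.Perm ι)) : Subalgebra ℂ (Laurent ι) where
  carrier := {f | ∀ g ∈ G, rename g f = f}
  mul_mem' := fun ha hb g hg => by rw [map_mul, ha g hg, hb g hg]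
  add_mem' := fun ha hb g hg => by rw [map_add, ha g hg, hb g hg]
  algebraMap_mem' := fun r g _ => AlgHom.commutes _ r

/-- `ℂ[z_1^{±1}, …, z_n^{±1}, h^{±1}] = K_T(pt)`, written as Laurent polynomials in
`z_1, …, z_n` whose coefficients are Laurent polynomials in `h`. -/
abbrev KPt (n : ℕ) : Type := AddMonoidAlgebra ℂ[T;T⁻¹] (Fin n → ℤ)

/-- The inclusion `ℂ[z^{±1}] → ℂ[z^{±1}, h^{±1}]`. -/
def inclZ (n : ℕ) : Laurent (Fin n) →ₐ[ℂ] KPt n :=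
  AddMonoidAlgebra.mapAlgHom (Fin n → ℤ) (Algebra.ofId ℂ ℂ[T;T⁻¹])

variable {N : ℕ}

/-- The index set of the variables `γ_{i,j}`, `1 ≤ i ≤ N`, `1 ≤ j ≤ λ_i`. -/
abbrev GammaIdx (lam : Fin N → ℕ) : Type := Σ i : Fin N, Fin (lam i)

/-- `S_λ = S_{λ_1} × ⋯ × S_{λ_N}`, permuting the variables `γ_{i,j}` with the same first index. -/
def blockPerms (lam : Fin N → ℕ) : Subgroup (Equiv.Perm (GammaIdx lam)) :=
  (Equiv.Perm.sigmaCongrRightHom fun i => Fin (lam i)).range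

/-- The algebra `ℂ[Γ^{±1}]^{S_λ} ⊗ ℂ[z^{±1}, h^{±1}]`. -/
def PreKT (n : ℕ) (lam : Fin N → ℕ) : Type :=
  invariants (blockPerms lam) ⊗[ℂ] KPt n

instance (n : ℕ) (lam : Fin N → ℕ) : CommRing (PreKT n lam) :=
  inferInstanceAs (CommRing (invariants (blockPerms lam) ⊗[ℂ] KPt n))

instance (n : ℕ) (lam : Fin N → ℕ) : Algebra ℂ (PreKT n lam) :=
  inferInstanceAs (Algebra ℂ (invariants (blockPerms lam) ⊗[ℂ] KPt n))

/-- The pure tensor `g ⊗ p` as an element of `ℂ[Γ^{±1}]^{S_λ} ⊗ ℂ[z^{±1}, h^{±1}]`. -/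
def PreKT.tmul {n : ℕ} {lam : Fin N → ℕ} (g : invariants (blockPerms lam)) (p : KPt n) :
    PreKT n lam :=
  g ⊗ₜ[ℂ] p

lemma rename_rename {ι κ μ : Type} (e : ι ≃ κ) (e' : κ ≃ μ) (f : Laurent ι) :
    rename e' (rename e f) = rename (e.trans e') f := by
  induction f using AddMonoidAlgebra.induction_linear with
  | zero => simp
  | add f g hf hg => simp [hf, hg]
  | single m r => simp [rename, Function.comp_def]

/-- A symmetric Laurent polynomial `f(z)`, read in the variables `γ_{i,j}` through a bijection
with `z_1, …, z_n`, is `S_λ`-invariant. -/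
lemma rename_mem_invariants {n : ℕ} {lam : Fin N → ℕ} (e : Fin n ≃ GammaIdx lam)
    (f : invariants (⊤ : Subgroup (Equiv.Perm (Fin n)))) :
    rename e f.1 ∈ invariants (blockPerms lam) := by
  intro g _
  rw [rename_rename]
  have h := f.2 ((e.trans g).trans e.symm) trivial
  conv_rhs => rw [← h, rename_rename]
  congr 2
  exact Equiv.ext fun x => (e.apply_symm_apply _).symm

/-- The ideal generated by the differences `f(Γ) - f(z)`, where `f` runs over
`ℂ[z^{±1}]^{S_n}`. As `f` is symmetric, `f(Γ)` does not depend on the bijection `e` that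
lists the variables `γ_{i,j}`. -/
def relIdeal (n : ℕ) (lam : Fin N → ℕ) : Ideal (PreKT n lam) :=
  Ideal.span {x | ∃ (e : Fin n ≃ GammaIdx lam)
      (f : invariants (⊤ : Subgroup (Equiv.Perm (Fin n)))),
    x = PreKT.tmul ⟨rename e f.1, rename_mem_invariants e f⟩ 1 - PreKT.tmul 1 (inclZ n f.1)}

/-- The equivariant K-theory algebra of the cotangent bundle of the partial flag variety
`F_λ`: `ℂ[Γ^{±1}]^{S_λ} ⊗ ℂ[z^{±1}, h^{±1}] / ⟨f(Γ) = f(z) : f ∈ ℂ[z^{±1}]^{S_n}⟩`. -/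
abbrev KT (n : ℕ) (lam : Fin N → ℕ) : Type := PreKT n lam ⧸ relIdeal n lam

/-- The set `𝓘_λ` of partitions of `{1, …, n}` into disjoint subsets `I_1, …, I_N` with
`|I_k| = λ_k`. Such a partition is recorded by the map that sends `a` to the `k` with
`a ∈ I_k`. -/
structure FlagIndex (n : ℕ) (lam : Fin N → ℕ) where
  block : Fin n → Fin N
  card_block : ∀ k, Fintype.card {a // block a = k} = lam k

namespace FlagIndex

variable {n : ℕ} {lam : Fin N → ℕ}

/-- The subset `I_k` of `{1, …, n}`. -/
def part (I : FlagIndex n lam) (k : Fin N) : Finset (Fin n) :=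
  Finset.univ.filter fun a => I.block a = k

/-- A bijection `(k, j) ↦ a` between the indices of the variables `γ_{k,j}` and `{1, …, n}`
that carries the `k`-th block to `I_k`. -/
def listing (I : FlagIndex n lam) : GammaIdx lam ≃ Fin n :=
  (Equiv.sigmaCongrRight fun k => (Fintype.equivFinOfCardEq (I.card_block k)).symm).trans
    (Equiv.sigmaFiberEquiv I.block)

lemma listing_mem (I : FlagIndex n lam) (x : GammaIdx lam) : I.listing x ∈ I.part x.1 := by
  simp only [part, Finset.mem_filter, Finset.mem_univ, true_and]
  exact ((Fintype.equivFinOfCardEq (I.card_block x.1)).symm x.2).2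

/-- The substitution `{γ_{k,1}, …, γ_{k,λ_k}} ↦ {z_a : a ∈ I_k}` for all `k`, before passing to
the quotient. On `S_λ`-invariants it does not depend on the order chosen inside the blocks. -/
def preLoc (I : FlagIndex n lam) : PreKT n lam →ₐ[ℂ] KPt n :=
  show invariants (blockPerms lam) ⊗[ℂ] KPt n →ₐ[ℂ] KPt n from Algebra.TensorProduct.lift
    ((inclZ n).comp ((rename I.listing).comp (invariants (blockPerms lam)).val))
    (AlgHom.id ℂ (KPt n)) (fun _ _ => Commute.all _ _)

lemma preLoc_tmul (I : FlagIndex n lam) (g : invariants (blockPerms lam)) (p : KPt n) :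
    I.preLoc (PreKT.tmul g p) = inclZ n (rename I.listing g.1) * p :=
  Algebra.TensorProduct.lift_tmul _ _ (fun _ _ => Commute.all _ _) g p

lemma preLoc_relIdeal (I : FlagIndex n lam) (x : PreKT n lam) (hx : x ∈ relIdeal n lam) :
    I.preLoc x = 0 := by
  refine (Ideal.span_le (I := RingHom.ker I.preLoc)).2 ?_ hx
  rintro _ ⟨e, f, rfl⟩
  have h : rename I.listing (rename e f.1) = f.1 := by
    rw [rename_rename]
    exact f.2 _ trivial
  simp [RingHom.mem_ker, preLoc_tmul, h]

/-- The restriction map `κ ↦ κ|_{x_I}` from `K_T(T^*F_λ)` to `K_T(x_I) = ℂ[z^{±1}, h^{±1}]`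
at the fixed point `x_I`. -/
def loc (I : FlagIndex n lam) : KT n lam →ₐ[ℂ] KPt n :=
  Ideal.Quotient.liftₐ (relIdeal n lam) I.preLoc I.preLoc_relIdeal

end FlagIndex

/-- The element `h` of `ℂ[z^{±1}, h^{±1}]`. -/
def hvar (n : ℕ) : KPt n := AddMonoidAlgebra.single 0 (LaurentPolynomial.T 1)

/-- The element `z_b / z_a` of `ℂ[z^{±1}, h^{±1}]`. -/
def zratio {n : ℕ} (b a : Fin n) : KPt n :=
  AddMonoidAlgebra.single (Pi.single b 1 - Pi.single a 1) 1

section Classes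

variable {n : ℕ} {lam : Fin N → ℕ}

/-- The product `∏_{k<l} ∏_{σ(a) ∈ I_k} ∏_{σ(b) ∈ I_l, r b a} F (σ b) (σ a)`. -/
def pairProd (r : Fin n → Fin n → Prop) [DecidableRel r] (F : Fin n → Fin n → KPt n)
    (σ : Equiv.Perm (Fin n)) (I : FlagIndex n lam) : KPt n :=
  ∏ k : Fin N, ∏ l ∈ Finset.univ.filter (fun l => k < l),
    ∏ a ∈ Finset.univ.filter (fun a => σ a ∈ I.part k),
      ∏ b ∈ Finset.univ.filter (fun b => σ b ∈ I.part l ∧ r b a), F (σ b) (σ a)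

/-- `e^{vert}_{σ,I,-} = ∏_{k<l} ∏_{σ(a) ∈ I_k} ∏_{σ(b) ∈ I_l, b<a} (1 - h z_{σ(b)}/z_{σ(a)})`. -/
def eVertMinus (σ : Equiv.Perm (Fin n)) (I : FlagIndex n lam) : KPt n :=
  pairProd (fun b a => b < a) (fun b a => 1 - hvar n * zratio b a) σ I

/-- `e^{hor}_{σ,I,-} = ∏_{k<l} ∏_{σ(a) ∈ I_k} ∏_{σ(b) ∈ I_l, b>a} (1 - z_{σ(a)}/z_{σ(b)})`. -/
def eHorMinus (σ : Equiv.Perm (Fin n)) (I : FlagIndex n lam) : KPt n :=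
  pairProd (fun b a => a < b) (fun b a => 1 - zratio a b) σ I

/-- `e_{σ,I} = e^{hor}_{σ,I,-} e^{vert}_{σ,I,-}`. -/
def eClass (σ : Equiv.Perm (Fin n)) (I : FlagIndex n lam) : KPt n :=
  eHorMinus σ I * eVertMinus σ I

/-- The polarization
`P_{σ,I} = ∏_{k<l} ∏_{σ(a) ∈ I_k} ∏_{σ(b) ∈ I_l, b>a} (- z_{σ(b)}/z_{σ(a)})`. -/
def polarization (σ : Equiv.Perm (Fin n)) (I : FlagIndex n lam) : KPt n :=
  pairProd (fun b a => a < b) (fun b a => -zratio b a) σ I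

/-- The Newton polygon `N(f) ⊂ ℝ^n`: the convex hull of the exponents `m ∈ ℤ^n` of the monomials
`z^m` whose coefficient in `f` is nonzero; `h` counts as a constant. -/
def newtonPolygon (f : KPt n) : Set (Fin n → ℝ) :=
  convexHull ℝ {v | ∃ m : Fin n → ℤ, f.coeff m ≠ 0 ∧ v = fun a => (m a : ℝ)}

/-- The linear map `φ_I : ℝ^n → ℝ` with `φ_I(ε_a) = k` if `a ∈ I_k`; the blocks are numbered
`1, …, N` here, hence the shift by one. -/
def phi (I : FlagIndex n lam) : (Fin n → ℝ) →ₗ[ℝ] ℝ :=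
  ∑ a : Fin n, (((I.block a : ℕ) : ℝ) + 1) • LinearMap.proj a

/-- The number `∑_{1 ≤ k < l ≤ N} λ_k λ_l (l - k)`. -/
def width (lam : Fin N → ℕ) : ℝ :=
  ∑ k : Fin N, ∑ l ∈ Finset.univ.filter (fun l => k < l),
    (lam k : ℝ) * (lam l : ℝ) * (((l : ℕ) : ℝ) - ((k : ℕ) : ℝ))

/-- `f` is `I`-small: `φ_I(N(f)) ⊂ [0, ∑_{k<l} λ_k λ_l (l - k) - 1]`. -/
def IsSmall (I : FlagIndex n lam) (f : KPt n) : Prop :=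
  phi I '' newtonPolygon f ⊆ Set.Icc 0 (width lam - 1)

end Classes

end EquivK

end

/-! Permuting the variables `z` acts on the K-theory algebra and permutes the fixed points
(`exists_loc_eq_permMap`), which reduces the theorem to `σ = 1`. There the polarization turns the
prescribed value at `x_I` into `fixClass`: the product, over pairs `a ∈ I_k`, `b ∈ I_l` with `k <
l`, of `1 - z_b/z_a` if `a < b` and of `1 - h z_b/z_a` otherwise. Every factor has positive
`φ_I`-degree, and these degrees add up to `W = ∑ λ_k λ_l (l - k)`. Smallness thus allows degrees in
`[0, W - 1]`, a strip one step too narrow for a nonzero multiple of `fixClass`.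

Uniqueness. Let a difference of two solutions vanish at `x_I`. Restrictions at `J` and at `J` with
`a, b` exchanged agree modulo `1 - z_b/z_a` (`oneSub_dvd_loc_sub_loc`). If the restrictions at all
`J` of smaller `weight` vanish, the one at `J ≠ I` is therefore divisible by the horizontal factors.
It is divisible by the vertical ones by assumption, hence by all of `fixClass` (`fixClass_dvd`), and
smallness makes it zero (`eq_zero_of_fixClass_dvd`). A class with all restrictions zero is zero
(`eq_of_loc_eq`): the algebra becomes a splitting algebra of `∏ (X - z_i)` once symmetry in the `γ`
is dropped, and averaging over `S_λ` recovers the invariant statement.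

Existence. For weakly increasing `I` an explicit product is supported at `x_I` alone
(`exists_isStable_of_monotone`). A Demazure–Lusztig operator then passes from `I` to its image under
an adjacent transposition that creates an inversion (`IsStable.exists_swap`), and every `I` is
reached by induction on inversions. -/

noncomputable section

namespace EquivK

/-! ### Binomials, degree strips and divisibility in the Laurent polynomial ring. -/

section LaurentRing

variable {n : ℕ}

/-- The vector `ε_b - ε_a`. -/
def rootVec (a b : Fin n) : Fin n → ℤ := Pi.single b 1 - Pi.single a 1

/-- The binomial `1 - c z^v`. -/
def oneSub (c : ℂ[T;T⁻¹]) (v : Fin n → ℤ) : KPt n := 1 - AddMonoidAlgebra.single v c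

lemma coeff_oneSub_mul (c : ℂ[T;T⁻¹]) (v m : Fin n → ℤ) (q : KPt n) :
    (oneSub c v * q).coeff m = q.coeff m - c * q.coeff (m - v) := by
  rw [oneSub, sub_mul, one_mul, AddMonoidAlgebra.coeff_sub, Finsupp.sub_apply,
    AddMonoidAlgebra.coeff_single_mul_apply, sub_eq_add_neg m v, add_comm m]

lemma oneSub_eq_zero_iff (c : ℂ[T;T⁻¹]) (v : Fin n → ℤ) :
    oneSub c v = 0 ↔ v = 0 ∧ c = 1 := by
  rw [oneSub, sub_eq_zero, eq_comm, AddMonoidAlgebra.one_def, AddMonoidAlgebra.single_inj]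
  simp

lemma one_sub_zratio (a b : Fin n) : 1 - zratio b a = oneSub 1 (rootVec a b) := rfl

lemma one_sub_hvar_mul_zratio (a b : Fin n) :
    1 - hvar n * zratio b a = oneSub (LaurentPolynomial.T 1) (rootVec a b) := by
  rw [hvar, zratio, AddMonoidAlgebra.single_mul_single, zero_add, mul_one, oneSub, rootVec]

/-- The exponents of `f` take values in `[lo, hi]` under `φ`. -/
def SuppIn (φ : (Fin n → ℤ) →+ ℤ) (lo hi : ℤ) (f : KPt n) : Prop :=
  ∀ m, f.coeff m ≠ 0 → lo ≤ φ m ∧ φ m ≤ hi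

namespace SuppIn

variable {φ : (Fin n → ℤ) →+ ℤ} {lo hi lo' hi' : ℤ} {f g : KPt n}

lemma zero : SuppIn φ lo hi (0 : KPt n) := fun _ hm => absurd rfl hm

lemma mono (hf : SuppIn φ lo hi f) (h₁ : lo' ≤ lo) (h₂ : hi ≤ hi') : SuppIn φ lo' hi' f :=
  fun m hm => ⟨h₁.trans (hf m hm).1, (hf m hm).2.trans h₂⟩

lemma sub (hf : SuppIn φ lo hi f) (hg : SuppIn φ lo hi g) : SuppIn φ lo hi (f - g) := by
  intro m hm
  by_cases h : f.coeff m = 0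
  · refine hg m fun h' => hm ?_
    rw [AddMonoidAlgebra.coeff_sub, Finsupp.sub_apply, h, h', sub_zero]
  · exact hf m h

lemma single (v : Fin n → ℤ) (c : ℂ[T;T⁻¹]) :
    SuppIn φ (φ v) (φ v) (AddMonoidAlgebra.single v c : KPt n) := by
  intro m hm
  have : v = m := by
    by_contra h
    exact hm (by rw [AddMonoidAlgebra.coeff_single, Finsupp.single_eq_of_ne (Ne.symm h)])
  simp [this]

lemma mul (hf : SuppIn φ lo hi f) (hg : SuppIn φ lo' hi' g) :
    SuppIn φ (lo + lo') (hi + hi') (f * g) := by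
  classical
  intro m hm
  have h := AddMonoidAlgebra.support_coeff_mul_subset f g (Finsupp.mem_support_iff.2 hm)
  obtain ⟨x, hx, y, hy, rfl⟩ := Finset.mem_add.1 h
  have h1 := hf x (Finsupp.mem_support_iff.1 hx)
  have h2 := hg y (Finsupp.mem_support_iff.1 hy)
  rw [map_add]
  omega

/-- An exponent of `f` outside the strip that is extreme in the direction `v` cannot cancel in the
product. Extremality is measured by `v ⬝ᵥ x` and not by `φ`, because `φ v = 0` is allowed. -/
lemma of_oneSub_mul {c : ℂ[T;T⁻¹]} (hc : c ≠ 0) {v : Fin n → ℤ} (hv : v ≠ 0) (hφ : 0 ≤ φ v)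
    (h : SuppIn φ lo (hi + φ v) (oneSub c v * f)) : SuppIn φ lo hi f := by
  have hpos : 0 < v ⬝ᵥ v := by
    refine lt_of_le_of_ne (Finset.sum_nonneg fun i _ => mul_self_nonneg _) fun h0 => hv ?_
    exact dotProduct_self_eq_zero.1 h0.symm
  intro m hm
  by_contra hcon
  rcases not_and_or.1 hcon with h1 | h1
  · obtain ⟨x, hx, hmin⟩ := (f.coeff.support.filter fun x => φ x < lo).exists_min_image
      (fun x => v ⬝ᵥ x) ⟨m, by simpa using ⟨hm, not_le.1 h1⟩⟩
    rw [Finset.mem_filter, Finsupp.mem_support_iff] at hx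
    have h0 : f.coeff (x - v) = 0 := by
      by_contra h0
      have := hmin (x - v) (Finset.mem_filter.2 ⟨Finsupp.mem_support_iff.2 h0, by
        rw [map_sub]; linarith [hx.2]⟩)
      rw [dotProduct_sub] at this
      omega
    have := (h x (by rw [coeff_oneSub_mul, h0, mul_zero, sub_zero]; exact hx.1)).1
    omega
  · obtain ⟨x, hx, hmax⟩ := (f.coeff.support.filter fun x => hi < φ x).exists_max_image
      (fun x => v ⬝ᵥ x) ⟨m, by simpa using ⟨hm, not_le.1 h1⟩⟩
    rw [Finset.mem_filter, Finsupp.mem_support_iff] at hx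
    have h0 : f.coeff (x + v) = 0 := by
      by_contra h0
      have := hmax (x + v) (Finset.mem_filter.2 ⟨Finsupp.mem_support_iff.2 h0, by
        rw [map_add]; linarith [hx.2]⟩)
      rw [dotProduct_add] at this
      omega
    have := (h (x + v) (by
      rw [coeff_oneSub_mul, h0, add_sub_cancel_right, zero_sub]
      exact neg_ne_zero.2 (mul_ne_zero hc hx.1))).2
    rw [map_add] at this
    omega

lemma of_prod_oneSub_mul {ι : Type*} (s : Finset ι) (c : ι → ℂ[T;T⁻¹]) (v : ι → Fin n → ℤ)
    (hc : ∀ i ∈ s, c i ≠ 0) (hv : ∀ i ∈ s, v i ≠ 0) (hφ : ∀ i ∈ s, 0 ≤ φ (v i))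
    (h : SuppIn φ lo (hi + ∑ i ∈ s, φ (v i)) ((∏ i ∈ s, oneSub (c i) (v i)) * f)) :
    SuppIn φ lo hi f := by
  classical
  induction s using Finset.induction_on generalizing f hi with
  | empty => simpa using h
  | insert i s hi' ih =>
    rw [Finset.prod_insert hi', Finset.sum_insert hi', mul_assoc, add_comm (φ _), ← add_assoc] at h
    exact ih (fun j hj => hc j (Finset.mem_insert_of_mem hj))
      (fun j hj => hv j (Finset.mem_insert_of_mem hj))
      (fun j hj => hφ j (Finset.mem_insert_of_mem hj))
      (of_oneSub_mul (hc i (Finset.mem_insert_self i s)) (hv i (Finset.mem_insert_self i s))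
        (hφ i (Finset.mem_insert_self i s)) h)

lemma oneSub (c : ℂ[T;T⁻¹]) {v : Fin n → ℤ} (hφ : 0 ≤ φ v) :
    SuppIn φ 0 (φ v) (EquivK.oneSub c v) := by
  refine sub ?_ ((single v c).mono hφ le_rfl)
  rw [AddMonoidAlgebra.one_def]
  have := single (φ := φ) (0 : Fin n → ℤ) 1
  rw [map_zero] at this
  exact this.mono le_rfl hφ

lemma prod_oneSub {ι : Type*} (s : Finset ι) (c : ι → ℂ[T;T⁻¹]) (v : ι → Fin n → ℤ)
    (hφ : ∀ i ∈ s, 0 ≤ φ (v i)) :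
    SuppIn φ 0 (∑ i ∈ s, φ (v i)) (∏ i ∈ s, EquivK.oneSub (c i) (v i)) := by
  classical
  induction s using Finset.induction_on with
  | empty =>
    rw [Finset.sum_empty, Finset.prod_empty, AddMonoidAlgebra.one_def]
    have := single (φ := φ) (0 : Fin n → ℤ) 1
    rwa [map_zero] at this
  | insert i s hi' ih =>
    rw [Finset.prod_insert hi', Finset.sum_insert hi']
    have := (oneSub (c i) (hφ i (Finset.mem_insert_self i s))).mul
      (ih fun j hj => hφ j (Finset.mem_insert_of_mem hj))
    rwa [add_zero] at this

end SuppIn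

lemma eq_zero_of_suppIn {φ : (Fin n → ℤ) →+ ℤ} {lo hi : ℤ} {f : KPt n}
    (h : SuppIn φ lo hi f) (hlt : hi < lo) : f = 0 := by
  ext1
  ext1 m
  by_contra hm
  have := h m hm
  omega

/-- The ring endomorphism of `ℂ[z^{±1}, h^{±1}]` induced by an additive map on exponents. -/
def expMap (e : (Fin n → ℤ) →+ (Fin n → ℤ)) : KPt n →ₐ[ℂ] KPt n :=
  AddMonoidAlgebra.mapDomainAlgHom ℂ ℂ[T;T⁻¹] e

lemma expMap_single (e : (Fin n → ℤ) →+ (Fin n → ℤ)) (m : Fin n → ℤ) (c : ℂ[T;T⁻¹]) :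
    expMap e (AddMonoidAlgebra.single m c) = AddMonoidAlgebra.single (e m) c :=
  AddMonoidAlgebra.mapDomain_single

lemma expMap_oneSub (e : (Fin n → ℤ) →+ (Fin n → ℤ)) (c : ℂ[T;T⁻¹]) (m : Fin n → ℤ) :
    expMap e (oneSub c m) = oneSub c (e m) := by
  rw [oneSub, map_sub, map_one, expMap_single, oneSub]

lemma expMap_expMap (e e' : (Fin n → ℤ) →+ (Fin n → ℤ)) (f : KPt n) :
    expMap e (expMap e' f) = expMap (e.comp e') f := by
  induction f using AddMonoidAlgebra.induction_linear with
  | zero => simp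
  | add f g hf hg => simp [hf, hg]
  | single m r => simp [expMap_single]

lemma SuppIn.expMap {φ : (Fin n → ℤ) →+ ℤ} {lo hi : ℤ} {f : KPt n}
    (e : (Fin n → ℤ) →+ (Fin n → ℤ)) (h : SuppIn (φ.comp e) lo hi f) :
    SuppIn φ lo hi (EquivK.expMap e f) := by
  classical
  intro m hm
  have h1 : m ∈ (Finsupp.mapDomain e f.coeff).support := Finsupp.mem_support_iff.2 hm
  obtain ⟨x, hx, rfl⟩ := Finset.mem_image.1 (Finsupp.mapDomain_support h1)
  exact h x (Finsupp.mem_support_iff.1 hx)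

/-- The map on exponents that corresponds to the substitution `z_b ↦ z_a`. -/
def mergeExp (a b : Fin n) : (Fin n → ℤ) →+ (Fin n → ℤ) where
  toFun m := m - m b • rootVec a b
  map_zero' := by simp
  map_add' m m' := by rw [Pi.add_apply, add_smul]; abel

lemma mergeExp_apply (a b : Fin n) (m : Fin n → ℤ) : mergeExp a b m = m - m b • rootVec a b := rfl

lemma oneSub_dvd_one_sub_zsmul (v : Fin n → ℤ) (k : ℤ) :
    oneSub 1 v ∣ 1 - AddMonoidAlgebra.single (k • v) (1 : ℂ[T;T⁻¹]) := by
  have hnat : ∀ k : ℕ, oneSub 1 v ∣ 1 - AddMonoidAlgebra.single (k • v) (1 : ℂ[T;T⁻¹]) := by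
    intro k
    have := sub_dvd_pow_sub_pow (1 : KPt n) (AddMonoidAlgebra.single v 1) k
    rwa [one_pow, AddMonoidAlgebra.single_pow, one_pow] at this
  obtain ⟨k, rfl | rfl⟩ := k.eq_nat_or_neg
  · simpa using hnat k
  · have h : AddMonoidAlgebra.single (k • v) (1 : ℂ[T;T⁻¹]) *
        AddMonoidAlgebra.single ((-(k : ℤ)) • v) 1 = (1 : KPt n) := by
      rw [AddMonoidAlgebra.single_mul_single, neg_smul, natCast_zsmul, add_neg_cancel, one_mul,
        ← AddMonoidAlgebra.one_def]
    obtain ⟨g, hg⟩ := hnat k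
    refine ⟨-(g * AddMonoidAlgebra.single ((-(k : ℤ)) • v) 1), ?_⟩
    linear_combination -h - hg * AddMonoidAlgebra.single ((-(k : ℤ)) • v) 1

lemma oneSub_dvd_sub_merge (a b : Fin n) (f : KPt n) :
    oneSub 1 (rootVec a b) ∣ f - expMap (mergeExp a b) f := by
  induction f using AddMonoidAlgebra.induction_linear with
  | zero => simp
  | add f g hf hg =>
    rw [map_add, add_sub_add_comm]
    exact dvd_add hf hg
  | single m r =>
    have h : (AddMonoidAlgebra.single m r : KPt n) -
        expMap (mergeExp a b) (AddMonoidAlgebra.single m r) =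
        (1 - AddMonoidAlgebra.single ((-m b) • rootVec a b) 1) * AddMonoidAlgebra.single m r := by
      rw [expMap_single, sub_mul, one_mul, AddMonoidAlgebra.single_mul_single, one_mul,
        mergeExp_apply, neg_smul, sub_eq_neg_add m]
    rw [h]
    exact (oneSub_dvd_one_sub_zsmul _ _).mul_right _

lemma mergeExp_rootVec {a b : Fin n} (hab : a ≠ b) : mergeExp a b (rootVec a b) = 0 := by
  simp [mergeExp_apply, rootVec, hab.symm]

/-- Modulo `1 - z_b/z_a` every `f` equals its image under `z_b ↦ z_a`, so this binomial generates
the kernel of the substitution. -/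
lemma oneSub_dvd_iff {a b : Fin n} (hab : a ≠ b) (f : KPt n) :
    oneSub 1 (rootVec a b) ∣ f ↔ expMap (mergeExp a b) f = 0 := by
  constructor
  · rintro ⟨g, rfl⟩
    rw [map_mul, expMap_oneSub, mergeExp_rootVec hab, (oneSub_eq_zero_iff _ _).2 ⟨rfl, rfl⟩,
      zero_mul]
  · intro h
    simpa [h] using oneSub_dvd_sub_merge a b f

/-- The kernel of a map into a domain is prime, so a factor that survives `z_b ↦ z_a` can be
cancelled. -/
lemma oneSub_dvd_of_dvd_mul {a b : Fin n} (hab : a ≠ b) {e g : KPt n}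
    (he : expMap (mergeExp a b) e ≠ 0) (h : oneSub 1 (rootVec a b) ∣ e * g) :
    oneSub 1 (rootVec a b) ∣ g := by
  rw [oneSub_dvd_iff hab, map_mul] at *
  exact (mul_eq_zero.1 h).resolve_left he

lemma mul_dvd_of_dvd {a b : Fin n} (hab : a ≠ b) {e f : KPt n}
    (he : expMap (mergeExp a b) e ≠ 0) (h : oneSub 1 (rootVec a b) ∣ f) (h' : e ∣ f) :
    e * oneSub 1 (rootVec a b) ∣ f := by
  obtain ⟨g, rfl⟩ := h'
  exact mul_dvd_mul_left e (oneSub_dvd_of_dvd_mul hab he h)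

lemma rootVec_ne_zero {a b : Fin n} (hab : a ≠ b) : rootVec a b ≠ 0 := by
  intro h
  have := congrFun h b
  simp [rootVec, hab.symm] at this

lemma T_ne_one : (LaurentPolynomial.T 1 : ℂ[T;T⁻¹]) ≠ 1 := by
  rw [← LaurentPolynomial.T_zero]
  intro h
  have := (AddMonoidAlgebra.single_left_inj (one_ne_zero (α := ℂ))).1 h
  omega

lemma T_ne_zero : (LaurentPolynomial.T 1 : ℂ[T;T⁻¹]) ≠ 0 :=
  AddMonoidAlgebra.single_ne_zero.2 one_ne_zero

lemma mergeExp_rootVec_ne_zero {a b c d : Fin n} (hcd : c ≠ d)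
    (h1 : (c, d) ≠ (a, b)) (h2 : (c, d) ≠ (b, a)) : mergeExp a b (rootVec c d) ≠ 0 := by
  intro h
  rw [mergeExp_apply] at h
  have hc := congrFun h c
  have hd := congrFun h d
  simp only [rootVec, Pi.sub_apply, Pi.smul_apply, Pi.single_apply, smul_eq_mul,
    Pi.zero_apply] at hc hd
  simp only [ne_eq, Prod.mk.injEq] at h1 h2
  grind

end LaurentRing

/-! ### Permutations of the variables `z`. -/

section Permutations

variable {n : ℕ}

/-- The map on exponents that corresponds to the permutation `z_a ↦ z_{τ a}`. -/
def permExp (τ : Equiv.Perm (Fin n)) : (Fin n → ℤ) →+ (Fin n → ℤ) where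
  toFun m := m ∘ τ.symm
  map_zero' := rfl
  map_add' _ _ := rfl

/-- The automorphism `z_a ↦ z_{τ a}` of `ℂ[z^{±1}, h^{±1}]`. -/
def permMap (τ : Equiv.Perm (Fin n)) : KPt n →ₐ[ℂ] KPt n := expMap (permExp τ)

lemma permExp_rootVec (τ : Equiv.Perm (Fin n)) (a b : Fin n) :
    permExp τ (rootVec a b) = rootVec (τ a) (τ b) := by
  ext c
  simp [permExp, rootVec, Pi.single_apply, Equiv.symm_apply_eq]

lemma permMap_oneSub_rootVec (τ : Equiv.Perm (Fin n)) (c : ℂ[T;T⁻¹]) (a b : Fin n) :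
    permMap τ (oneSub c (rootVec a b)) = oneSub c (rootVec (τ a) (τ b)) := by
  rw [permMap, expMap_oneSub, permExp_rootVec]

lemma permMap_permMap_symm (τ : Equiv.Perm (Fin n)) (f : KPt n) :
    permMap τ (permMap τ.symm f) = f := by
  rw [permMap, permMap, expMap_expMap]
  have : (permExp τ).comp (permExp τ.symm) = AddMonoidHom.id _ := by
    ext m c
    simp [permExp]
  rw [this]
  induction f using AddMonoidAlgebra.induction_linear with
  | zero => simp
  | add f g hf hg => simp [hf, hg]
  | single m r => simp [expMap_single]

lemma permMap_injective (τ : Equiv.Perm (Fin n)) : Function.Injective (permMap τ) := by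
  intro f g h
  have := permMap_permMap_symm τ.symm
  simp only [Equiv.symm_symm] at this
  rw [← this f, h, this g]

lemma mergeExp_permExp_swap (a b : Fin n) :
    (mergeExp a b).comp (permExp (Equiv.swap a b)) = mergeExp a b := by
  refine AddMonoidHom.ext fun m => ?_
  ext c
  simp only [AddMonoidHom.comp_apply, mergeExp_apply, permExp, AddMonoidHom.coe_mk,
    ZeroHom.coe_mk, Pi.sub_apply, Pi.smul_apply, Function.comp_apply, Equiv.symm_swap,
    Equiv.swap_apply_right, smul_eq_mul, rootVec, Pi.single_apply, Equiv.swap_apply_def]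
  split_ifs <;> (simp_all; try ring)

lemma merge_permMap_swap (a b : Fin n) (f : KPt n) :
    expMap (mergeExp a b) (permMap (Equiv.swap a b) f) = expMap (mergeExp a b) f := by
  rw [permMap, expMap_expMap, mergeExp_permExp_swap]

lemma permMap_inclZ (τ : Equiv.Perm (Fin n)) (f : Laurent (Fin n)) :
    permMap τ (inclZ n f) = inclZ n (rename τ f) := by
  induction f using AddMonoidAlgebra.induction_linear with
  | zero => simp
  | add f g hf hg => simp [hf, hg]
  | single m r =>
    have h1 : ∀ m : Fin n → ℤ, inclZ n (AddMonoidAlgebra.single m r) =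
        AddMonoidAlgebra.single m (algebraMap ℂ ℂ[T;T⁻¹] r) :=
      fun m => AddMonoidAlgebra.map_single _ _ _
    have h2 : rename τ (AddMonoidAlgebra.single m r) =
        AddMonoidAlgebra.single (m ∘ τ.symm) r := AddMonoidAlgebra.mapDomain_single
    rw [h1, permMap, expMap_single, h2, h1]
    rfl

end Permutations

/-! ### Restriction to fixed points, the permutation action and the Demazure–Lusztig operators. -/

section Localization

variable {N n : ℕ} {lam : Fin N → ℕ}

lemma mem_blockPerms (g : Equiv.Perm (GammaIdx lam)) (hg : ∀ x, (g x).1 = x.1) :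
    g ∈ blockPerms lam := by
  have hg' : ∀ x, (g.symm x).1 = x.1 := fun x => by
    rw [← hg (g.symm x), g.apply_symm_apply]
  have key : ∀ (i : Fin N) (y : GammaIdx lam) (h : y.1 = i),
      (⟨i, Fin.cast (congrArg lam h) y.2⟩ : GammaIdx lam) = y := by
    rintro i ⟨_, _⟩ rfl
    rfl
  refine ⟨fun i => ⟨fun j => Fin.cast (congrArg lam (hg ⟨i, j⟩)) (g ⟨i, j⟩).2,
    fun j => Fin.cast (congrArg lam (hg' ⟨i, j⟩)) (g.symm ⟨i, j⟩).2,
    fun j => ?_, fun j => ?_⟩, ?_⟩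
  · refine sigma_mk_injective (β := fun i => Fin (lam i)) (i := i)
      ((key i (g.symm ⟨i, _⟩) (hg' ⟨i, _⟩)).trans ?_)
    rw [key i _ (hg ⟨i, j⟩), g.symm_apply_apply]
  · refine sigma_mk_injective (β := fun i => Fin (lam i)) (i := i)
      ((key i (g ⟨i, _⟩) (hg ⟨i, _⟩)).trans ?_)
    rw [key i _ (hg' ⟨i, j⟩), g.apply_symm_apply]
  · exact Equiv.ext fun x => key x.1 (g x) (hg x)

namespace FlagIndex

/-- The partition `τ⁻¹(J)`. -/
def comapPerm (J : FlagIndex n lam) (τ : Equiv.Perm (Fin n)) : FlagIndex n lam where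
  block a := J.block (τ a)
  card_block k := by
    rw [← J.card_block k]
    exact Fintype.card_congr (τ.subtypeEquiv fun _ => Iff.rfl)

lemma block_injective : Function.Injective (block : FlagIndex n lam → _) := by
  rintro ⟨_, _⟩ ⟨_, _⟩ rfl
  rfl

@[simp] lemma comapPerm_block (J : FlagIndex n lam) (τ : Equiv.Perm (Fin n)) (a : Fin n) :
    (J.comapPerm τ).block a = J.block (τ a) := rfl

lemma comapPerm_symm_comapPerm (J : FlagIndex n lam) (τ : Equiv.Perm (Fin n)) :
    (J.comapPerm τ.symm).comapPerm τ = J :=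
  block_injective (funext fun a => by simp)

lemma comapPerm_comapPerm_symm (J : FlagIndex n lam) (τ : Equiv.Perm (Fin n)) :
    (J.comapPerm τ).comapPerm τ.symm = J :=
  block_injective (funext fun a => by simp)

lemma comapPerm_injective (τ : Equiv.Perm (Fin n)) :
    Function.Injective fun J : FlagIndex n lam => J.comapPerm τ := by
  intro J K h
  rw [← J.comapPerm_comapPerm_symm τ, ← K.comapPerm_comapPerm_symm τ]
  exact congrArg (fun L => L.comapPerm τ.symm) h

lemma block_listing (J : FlagIndex n lam) (x : GammaIdx lam) : J.block (J.listing x) = x.1 :=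
  (Finset.mem_filter.1 (J.listing_mem x)).2

/-- Two listings that respect the blocks differ by an element of `S_λ`, which `g` does not see. -/
lemma rename_listing (J : FlagIndex n lam) (g : invariants (blockPerms lam))
    (w : GammaIdx lam ≃ Fin n) (hw : ∀ x, J.block (w x) = x.1) :
    rename J.listing g.1 = rename w g.1 := by
  have h := g.2 (w.trans J.listing.symm) (mem_blockPerms _ fun x => by
    rw [← J.block_listing, Equiv.trans_apply, Equiv.apply_symm_apply, hw])
  conv_lhs => rw [← h, rename_rename]
  congr 2
  ext x
  simp

lemma rename_listing_comapPerm (J : FlagIndex n lam) (τ : Equiv.Perm (Fin n))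
    (g : invariants (blockPerms lam)) :
    rename J.listing g.1 = rename τ (rename (J.comapPerm τ).listing g.1) := by
  rw [rename_rename]
  exact J.rename_listing g _ fun x => (J.comapPerm τ).block_listing x

lemma loc_mk (J : FlagIndex n lam) (x : PreKT n lam) :
    J.loc (Ideal.Quotient.mk _ x) = J.preLoc x := rfl

end FlagIndex

/-- The class in `K_T(T^*F_λ)` of a pure tensor. -/
def KT.tmul (g : invariants (blockPerms lam)) (p : KPt n) : KT n lam :=
  Ideal.Quotient.mk _ (PreKT.tmul g p)

lemma FlagIndex.loc_tmul (J : FlagIndex n lam) (g : invariants (blockPerms lam)) (p : KPt n) :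
    J.loc (KT.tmul g p) = inclZ n (rename J.listing g.1) * p := by
  rw [KT.tmul, J.loc_mk, J.preLoc_tmul]

lemma PreKT.induction {motive : PreKT n lam → Prop} (x : PreKT n lam) (zero : motive 0)
    (tmul : ∀ g p, motive (PreKT.tmul g p)) (add : ∀ x y, motive x → motive y → motive (x + y)) :
    motive x :=
  TensorProduct.induction_on (motive := motive) x zero tmul add

lemma KT.induction {motive : KT n lam → Prop} (κ : KT n lam) (zero : motive 0)
    (tmul : ∀ g p, motive (KT.tmul g p)) (add : ∀ x y, motive x → motive y → motive (x + y)) :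
    motive κ := by
  obtain ⟨x, rfl⟩ := Ideal.Quotient.mk_surjective κ
  induction x using PreKT.induction with
  | zero => rwa [map_zero]
  | tmul g p => exact tmul g p
  | add x y hx hy => rw [map_add]; exact add _ _ hx hy

lemma exists_loc_eq_permMap (τ : Equiv.Perm (Fin n)) (κ : KT n lam) :
    ∃ κ' : KT n lam, ∀ J : FlagIndex n lam,
      J.loc κ' = permMap τ ((J.comapPerm τ).loc κ) := by
  induction κ using KT.induction with
  | zero => exact ⟨0, fun J => by simp⟩
  | tmul g p =>
    refine ⟨KT.tmul g (permMap τ p), fun J => ?_⟩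
    rw [J.loc_tmul, FlagIndex.loc_tmul, map_mul, permMap_inclZ, ← J.rename_listing_comapPerm]
  | add x y hx hy =>
    obtain ⟨x', hx⟩ := hx
    obtain ⟨y', hy⟩ := hy
    exact ⟨x' + y', fun J => by simp only [map_add, hx J, hy J]⟩

/-- The Demazure–Lusztig operator for the transposition of `a` and `b`. -/
lemma exists_loc_demazureLusztig {a b : Fin n} (hab : a ≠ b) (κ : KT n lam) :
    ∃ κ' : KT n lam, ∀ J : FlagIndex n lam,
      oneSub 1 (rootVec a b) * J.loc κ' = (1 - hvar n) * J.loc κ -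
        (zratio b a - hvar n) *
          permMap (Equiv.swap a b) ((J.comapPerm (Equiv.swap a b)).loc κ) := by
  induction κ using KT.induction with
  | zero => exact ⟨0, fun J => by simp⟩
  | tmul g p =>
    -- At `z_b = z_a` both coefficients become `1 - h` and the transposition acts trivially. The
    -- operator touches only the `z`-factor of the tensor.
    have hdvd : oneSub 1 (rootVec a b) ∣ (1 - hvar n) * p -
        (zratio b a - hvar n) * permMap (Equiv.swap a b) p := by
      have h0 : expMap (mergeExp a b) (oneSub 1 (rootVec a b)) = 0 :=
        (oneSub_dvd_iff hab _).1 dvd_rfl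
      rw [oneSub_dvd_iff hab, map_sub, map_mul, map_mul, merge_permMap_swap, ← sub_mul,
        ← map_sub]
      have : 1 - hvar n - (zratio b a - hvar n) = oneSub 1 (rootVec a b) := by
        rw [← one_sub_zratio]; ring
      rw [this, h0, zero_mul]
    obtain ⟨q, hq⟩ := hdvd
    refine ⟨KT.tmul g q, fun J => ?_⟩
    rw [J.loc_tmul, J.loc_tmul, FlagIndex.loc_tmul, map_mul, permMap_inclZ,
      ← J.rename_listing_comapPerm]
    linear_combination -(inclZ n (rename J.listing g.1)) * hq
  | add x y hx hy =>
    obtain ⟨x', hx⟩ := hx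
    obtain ⟨y', hy⟩ := hy
    refine ⟨x' + y', fun J => ?_⟩
    simp only [map_add]
    linear_combination hx J + hy J

/-- The two fixed points differ by exchanging `z_a` and `z_b` in the `γ`-part, which is invisible at
`z_a = z_b`. This is the GKM congruence. -/
lemma oneSub_dvd_loc_sub_loc {a b : Fin n} (hab : a ≠ b) (κ : KT n lam) (J : FlagIndex n lam) :
    oneSub 1 (rootVec a b) ∣ J.loc κ - (J.comapPerm (Equiv.swap a b)).loc κ := by
  induction κ using KT.induction with
  | zero => simp
  | tmul g p =>
    rw [J.loc_tmul, FlagIndex.loc_tmul, J.rename_listing_comapPerm (Equiv.swap a b),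
      ← permMap_inclZ, ← sub_mul]
    refine Dvd.dvd.mul_right ?_ _
    rw [oneSub_dvd_iff hab, map_sub, merge_permMap_swap, sub_self]
  | add x y hx hy =>
    rw [map_add, map_add, add_sub_add_comm]
    exact dvd_add hx hy

end Localization

/-! ### An algebra generated by the roots of a split polynomial is detected by its evaluations. -/

section Splitting

open Polynomial

variable {R Q : Type*} [CommRing R] [IsDomain R] [CommRing Q] [Algebra R Q] {n : ℕ}

/-- Induction on the number of adjoined roots. The next root satisfies a monic equation of degree `n
- k` over the previous algebra `S`, so `y` is a polynomial in it of smaller degree. Each evaluation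
of `S` extends so that this polynomial vanishes at `n - k` distinct points of the domain `R`. Its
coefficients therefore evaluate to zero, and vanish by induction. -/
lemma eq_zero_of_mem_adjoin_roots (γ : Fin n → Q) (z : Fin n → R) (hz : Function.Injective z)
    (hrel : ∏ i, (X - C (γ i)) = (∏ i, (X - C (z i))).map (algebraMap R Q))
    (ev : Equiv.Perm (Fin n) → Q →ₐ[R] R) (hev : ∀ w i, ev w (γ i) = z (w i)) (k : ℕ)
    (hk : k ≤ n) (y : Q) (hy : y ∈ Algebra.adjoin R (γ '' {i | (i : ℕ) < k}))
    (h0 : ∀ w, ev w y = 0) : y = 0 := by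
  classical
  induction k generalizing y with
  | zero =>
    simp only [not_lt_zero, Set.ofPred_false, Set.image_empty, Algebra.adjoin_empty] at hy
    obtain ⟨r, rfl⟩ := Algebra.mem_bot.1 hy
    have := h0 1
    rw [AlgHom.commutes] at this
    rw [show r = 0 from this, map_zero]
  | succ k ih =>
    set S := Algebra.adjoin R (γ '' {i | (i : ℕ) < k})
    have hmem : ∀ i : Fin n, (i : ℕ) < k → γ i ∈ S := fun i hi =>
      Algebra.subset_adjoin ⟨i, hi, rfl⟩
    set a : Fin n := ⟨k, hk⟩ with ha
    -- elements of the larger algebra are polynomials in the new root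
    obtain ⟨p, rfl⟩ : ∃ p : S[X], aeval (γ a) p = y := by
      have hle : Algebra.adjoin R (γ '' {i | (i : ℕ) < k + 1}) ≤
          ((aeval (R := S) (γ a)).restrictScalars R).range := by
        refine Algebra.adjoin_le ?_
        rintro _ ⟨i, hi, rfl⟩
        rcases Nat.lt_succ_iff_lt_or_eq.1 hi with hi | hi
        · refine ⟨C ⟨γ i, hmem i hi⟩, ?_⟩
          simp
        · refine ⟨X, ?_⟩
          have : i = a := Fin.ext hi
          simp [this]
      obtain ⟨p, hp⟩ := hle hy
      exact ⟨p, hp⟩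
    let s : Finset (Fin n) := Finset.univ.filter fun i => (i : ℕ) < k
    let t : Finset (Fin n) := Finset.univ.filter fun i => ¬ (i : ℕ) < k
    -- Dividing by the linear factors of the adjoined roots gives the product over the remaining
    -- roots, now with coefficients in `S`.
    let g : S[X] := ∏ i ∈ s.attach, (X - C ⟨γ i, hmem i (Finset.mem_filter.1 i.2).2⟩)
    let P : S[X] := (∏ i, (X - C (z i))).map (algebraMap R S)
    have hg : g.Monic := monic_prod_of_monic _ _ fun i _ => monic_X_sub_C _
    let f : S[X] := P /ₘ g
    have hinj : Function.Injective (S.val : S →+* Q) := Subtype.val_injective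
    have hgmap : g.map (S.val : S →+* Q) = ∏ i ∈ s, (X - C (γ i)) := by
      rw [← Finset.prod_attach s, Polynomial.map_prod]
      refine Finset.prod_congr rfl fun i _ => ?_
      rw [Polynomial.map_sub, map_X, map_C]
      rfl
    have hfmap : f.map (S.val : S →+* Q) = ∏ i ∈ t, (X - C (γ i)) := by
      have hP : P.map (S.val : S →+* Q) = (∏ i ∈ s, (X - C (γ i))) * ∏ i ∈ t, (X - C (γ i)) := by
        rw [Finset.prod_filter_mul_prod_filter_not, hrel, Polynomial.map_map]
        rfl
      rw [map_divByMonic _ hg, hP, hgmap]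
      exact mul_divByMonic_cancel_left _ (monic_prod_of_monic _ _ fun i _ => monic_X_sub_C _)
    have hfm : f.Monic := by
      refine monic_of_injective hinj ?_
      rw [hfmap]
      exact monic_prod_of_monic _ _ fun i _ => monic_X_sub_C _
    have hroot : aeval (γ a) f = 0 := by
      have h1 : aeval (γ a) f = (f.map (S.val : S →+* Q)).eval (γ a) := by
        rw [eval_map]
        rfl
      rw [h1, hfmap, eval_prod]
      exact Finset.prod_eq_zero (i := a) (by simp [t, ha]) (by simp)
    have hred : aeval (γ a) p = aeval (γ a) (p %ₘ f) := by
      conv_lhs => rw [← modByMonic_add_div p f]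
      rw [map_add, map_mul, hroot, zero_mul, add_zero]
    have hcoeff : ∀ w j, ev w ((p %ₘ f).coeff j : Q) = 0 := by
      intro w j
      have hQ : Nontrivial Q := (ev 1).toRingHom.domain_nontrivial
      let r : R[X] := (p %ₘ f).map ((ev w : Q →+* R).comp (S.val : S →+* Q))
      have hdeg : r.degree < t.card := by
        refine degree_map_le.trans_lt ((degree_modByMonic_lt p hfm).trans_le ?_)
        rw [← degree_map_eq_of_injective hinj, hfmap, degree_prod_of_monic _ _ fun i _ =>
          monic_X_sub_C _]
        simp [degree_X_sub_C]
      have hr : r = 0 := by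
        refine eq_zero_of_degree_lt_of_eval_finset_eq_zero (t.image fun i => z (w i)) ?_ ?_
        · rwa [Finset.card_image_of_injective (f := fun i => z (w i)) _ (hz.comp w.injective)]
        · intro x hx
          obtain ⟨b, hb, rfl⟩ := Finset.mem_image.1 hx
          have hb : ¬ (b : ℕ) < k := (Finset.mem_filter.1 hb).2
          -- As `a` and `b` are both at least `k`, this leaves the evaluation on `S` unchanged but
          -- sends `γ a` to `z (w b)`.
          let w' := (Equiv.swap a b).trans w
          have hS' : ∀ c ∈ S, ev w' c = ev w c := by
            intro c hc
            have hle : S ≤ AlgHom.equalizer (ev w') (ev w) := by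
              refine Algebra.adjoin_le ?_
              rintro _ ⟨i, hi, rfl⟩
              have h1 : i ≠ a := fun h => (show (i : ℕ) < k from hi).ne (congrArg Fin.val h)
              have h2 : i ≠ b := fun h => hb (h ▸ hi)
              change ev w' (γ i) = ev w (γ i)
              rw [hev, hev, Equiv.trans_apply, Equiv.swap_apply_of_ne_of_ne h1 h2]
            exact hle hc
          have h1 : r.eval (z (w b)) = ev w' (aeval (γ a) (p %ₘ f)) := by
            rw [eval_map, aeval_def, ← AlgHom.coe_toRingHom (ev w'), hom_eval₂]
            have h2 : (ev w').toRingHom (γ a) = z (w b) := by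
              change ev w' (γ a) = _
              rw [hev, Equiv.trans_apply, Equiv.swap_apply_left]
            rw [show ((ev w' : Q →ₐ[R] R) : Q →+* R) (γ a) = z (w b) from h2]
            congr 1
            refine RingHom.ext fun c => ?_
            exact (hS' c c.2).symm
          rw [h1, ← hred]
          exact h0 w'
      have := congrArg (fun q => coeff q j) hr
      simp only [r, coeff_map, coeff_zero] at this
      exact this
    rw [hred]
    have hzero : p %ₘ f = 0 := by
      ext j
      exact ih (Nat.le_of_succ_le hk) _ ((p %ₘ f).coeff j).2 fun w => hcoeff w j
    rw [hzero, map_zero]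

end Splitting

/-! ### The Reynolds operator of a group of permutations. -/

section Averaging

variable {ι : Type}

/-- The projection of the Laurent polynomials to the invariants of `G`. -/
def average (G : Subgroup (Equiv.Perm ι)) : Laurent ι →ₗ[ℂ] Laurent ι :=
  (Nat.card G : ℂ)⁻¹ • ∑ᶠ g : G, (rename g.1).toLinearMap

lemma average_apply (G : Subgroup (Equiv.Perm ι)) [Fintype G] (f : Laurent ι) :
    average G f = (Nat.card G : ℂ)⁻¹ • ∑ g : G, rename g.1 f := by
  rw [average, finsum_eq_sum_of_fintype]
  simp

lemma average_mem [Finite ι] (G : Subgroup (Equiv.Perm ι)) (f : Laurent ι) :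
    average G f ∈ invariants G := by
  classical
  have := Fintype.ofFinite G
  intro h hh
  rw [average_apply, map_smul, map_sum]
  congr 1
  simp only [rename_rename]
  exact Fintype.sum_equiv (Equiv.mulLeft (⟨h, hh⟩ : G)) _ _ fun g => rfl

lemma average_mul_of_invariant [Finite ι] (G : Subgroup (Equiv.Perm ι)) (f s : Laurent ι)
    (hs : s ∈ invariants G) : average G (f * s) = average G f * s := by
  classical
  have := Fintype.ofFinite G
  rw [average_apply, average_apply, smul_mul_assoc, Finset.sum_mul]
  congr 1
  refine Finset.sum_congr rfl fun g _ => ?_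
  rw [map_mul, hs g.1 g.2]

lemma average_of_invariant [Finite ι] (G : Subgroup (Equiv.Perm ι)) (s : Laurent ι)
    (hs : s ∈ invariants G) : average G s = s := by
  classical
  have := Fintype.ofFinite G
  rw [average_apply, Finset.sum_congr rfl fun (g : G) _ => hs g.1 g.2, Finset.sum_const,
    Finset.card_univ, ← Nat.card_eq_fintype_card, ← Nat.cast_smul_eq_nsmul ℂ, smul_smul,
    inv_mul_cancel₀ (Nat.cast_ne_zero.2 Nat.card_pos.ne'), one_smul]

end Averaging

/-! ### Generators of the Laurent polynomial ring. -/

section Variables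

variable {ι κ : Type}

/-- The Laurent monomial with exponents `m`. -/
def mono (m : ι → ℤ) : Laurent ι := AddMonoidAlgebra.single m 1

lemma rename_mono (e : ι ≃ κ) (m : ι → ℤ) : rename e (mono m) = mono (m ∘ e.symm) :=
  AddMonoidAlgebra.mapDomain_single

lemma mono_add (m m' : ι → ℤ) : mono (m + m') = mono m * mono m' := by
  rw [mono, mono, mono, AddMonoidAlgebra.single_mul_single, one_mul]

variable [DecidableEq ι] [DecidableEq κ]

/-- The variable `x_i`. -/
def var (i : ι) : Laurent ι := mono (Pi.single i 1)

lemma rename_var (e : ι ≃ κ) (i : ι) : rename e (var i) = var (e i) := by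
  rw [var, rename_mono, var]
  congr 1
  ext j
  simp [Pi.single_apply, Equiv.symm_apply_eq]

lemma prod_var_pow [Fintype ι] (k : ι → ℕ) :
    ∏ i, var i ^ k i = mono fun i => (k i : ℤ) := by
  simp only [var, mono, AddMonoidAlgebra.single_pow, one_pow, AddMonoidAlgebra.prod_single,
    Finset.prod_const_one]
  congr 1
  ext j
  simp [Finset.sum_apply, Pi.single_apply]

omit [DecidableEq ι] in
lemma mono_const_mem_invariants (G : Subgroup (Equiv.Perm ι)) (c : ℤ) :
    mono (fun _ : ι => c) ∈ invariants G := fun g _ => by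
  rw [rename_mono]
  rfl

/-- The variables and the inverse of their product generate the Laurent ring over the constants.
That single inverse is symmetric, hence controlled by the relations `f(Γ) = f(z)`. -/
lemma mem_of_var_mem {A : Type*} [CommRing A] [Fintype ι] (F : Laurent ι →+* A)
    (S : Subring A) (hconst : ∀ r, F (algebraMap ℂ _ r) ∈ S) (hvar : ∀ i, F (var i) ∈ S)
    (hneg : F (mono fun _ => -1) ∈ S) (f : Laurent ι) : F f ∈ S := by
  induction f using AddMonoidAlgebra.induction_linear with
  | zero => rw [map_zero]; exact S.zero_mem
  | add f g hf hg => rw [map_add]; exact S.add_mem hf hg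
  | single m r =>
    let M : ℕ := ∑ i, (m i).natAbs
    have hM : ∀ i, 0 ≤ m i + M := fun i => by
      have : (m i).natAbs ≤ M :=
        Finset.single_le_sum (f := fun i => (m i).natAbs) (fun _ _ => Nat.zero_le _)
          (Finset.mem_univ i)
      omega
    have hpow : mono (fun _ : ι => -1) ^ M = mono fun _ => -(M : ℤ) := by
      rw [mono, AddMonoidAlgebra.single_pow, one_pow, mono]
      congr 1
      ext
      simp
    have h : (AddMonoidAlgebra.single m r : Laurent ι) =
        algebraMap ℂ _ r * ((∏ i, var i ^ (m i + M).toNat) * mono (fun _ => -1) ^ M) := by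
      rw [prod_var_pow, hpow, ← mono_add, mono, ← Algebra.smul_def, AddMonoidAlgebra.smul_single,
        smul_eq_mul, mul_one]
      congr 1
      ext i
      simp only [Pi.add_apply, Int.toNat_of_nonneg (hM i)]
      ring
    rw [h, map_mul, map_mul, map_prod, map_pow]
    refine S.mul_mem (hconst r) (S.mul_mem (S.prod_mem fun i _ => ?_) (S.pow_mem hneg _))
    rw [map_pow]
    exact S.pow_mem (hvar i) _

end Variables

/-! ### Injectivity of localization at the fixed points. -/

section Splitting

variable {N n : ℕ} {lam : Fin N → ℕ}

/-- The algebra `ℂ[z^{±1}, h^{±1}] ⊗ ℂ[Γ^{±1}]`. -/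
def PreFull (n : ℕ) (lam : Fin N → ℕ) : Type := KPt n ⊗[ℂ] Laurent (GammaIdx lam)

instance : CommRing (PreFull n lam) :=
  inferInstanceAs (CommRing (KPt n ⊗[ℂ] Laurent (GammaIdx lam)))

instance : Algebra (KPt n) (PreFull n lam) :=
  inferInstanceAs (Algebra (KPt n) (KPt n ⊗[ℂ] Laurent (GammaIdx lam)))

/-- A pure tensor in `ℂ[z^{±1}, h^{±1}] ⊗ ℂ[Γ^{±1}]`. -/
def PreFull.tmul (p : KPt n) (f : Laurent (GammaIdx lam)) : PreFull n lam := p ⊗ₜ[ℂ] f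

lemma PreFull.induction {motive : PreFull n lam → Prop} (x : PreFull n lam) (zero : motive 0)
    (tmul : ∀ p f, motive (PreFull.tmul p f))
    (add : ∀ x y, motive x → motive y → motive (x + y)) : motive x :=
  TensorProduct.induction_on (motive := motive) x zero tmul add

lemma PreFull.tmul_mul_tmul (p p' : KPt n) (f f' : Laurent (GammaIdx lam)) :
    PreFull.tmul p f * PreFull.tmul p' f' = PreFull.tmul (p * p') (f * f') :=
  Algebra.TensorProduct.tmul_mul_tmul _ _ _ _

lemma PreFull.algebraMap_apply (p : KPt n) :
    algebraMap (KPt n) (PreFull n lam) p = PreFull.tmul p 1 := rfl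

/-- The inclusion of `ℂ[Γ^{±1}]`. -/
def PreFull.inclGamma : Laurent (GammaIdx lam) →+* PreFull n lam :=
  ((Algebra.TensorProduct.includeRight :
    Laurent (GammaIdx lam) →ₐ[ℂ] KPt n ⊗[ℂ] Laurent (GammaIdx lam)) :
      Laurent (GammaIdx lam) →+* KPt n ⊗[ℂ] Laurent (GammaIdx lam))

lemma PreFull.inclGamma_algebraMap (r : ℂ) :
    PreFull.inclGamma (algebraMap ℂ (Laurent (GammaIdx lam)) r) =
      algebraMap (KPt n) (PreFull n lam) (algebraMap ℂ (KPt n) r) :=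
  (Algebra.TensorProduct.tmul_one_eq_one_tmul r).symm

/-- The ideal of `ℂ[z^{±1}, h^{±1}] ⊗ ℂ[Γ^{±1}]` generated by the differences `f(Γ) - f(z)`. -/
def fullIdeal (n : ℕ) (lam : Fin N → ℕ) : Ideal (PreFull n lam) :=
  Ideal.span {x | ∃ (e : Fin n ≃ GammaIdx lam)
      (f : invariants (⊤ : Subgroup (Equiv.Perm (Fin n)))),
    x = PreFull.tmul 1 (rename e f.1) - PreFull.tmul (inclZ n f.1) 1}

/-- The substitution `γ_x ↦ z_{w x}`. -/
def evalFull (w : GammaIdx lam ≃ Fin n) : PreFull n lam →ₐ[KPt n] KPt n :=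
  show KPt n ⊗[ℂ] Laurent (GammaIdx lam) →ₐ[KPt n] KPt n from
  Algebra.TensorProduct.lift (AlgHom.id (KPt n) (KPt n)) ((inclZ n).comp (rename w))
    (fun _ _ => Commute.all _ _)

lemma evalFull_tmul (w : GammaIdx lam ≃ Fin n) (p : KPt n) (g : Laurent (GammaIdx lam)) :
    evalFull w (PreFull.tmul p g) = p * inclZ n (rename w g) :=
  Algebra.TensorProduct.lift_tmul _ _ (fun _ _ => Commute.all _ _) p g

lemma evalFull_fullIdeal (w : GammaIdx lam ≃ Fin n) (x : PreFull n lam)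
    (hx : x ∈ fullIdeal n lam) : evalFull w x = 0 := by
  refine (Ideal.span_le (I := RingHom.ker (evalFull w))).2 ?_ hx
  rintro _ ⟨e, f, rfl⟩
  have h : rename w (rename e f.1) = f.1 := by
    rw [rename_rename]
    exact f.2 _ trivial
  simp [RingHom.mem_ker, evalFull_tmul, h]

lemma inclZ_single (m : Fin n → ℤ) (r : ℂ) : inclZ n (AddMonoidAlgebra.single m r) =
    AddMonoidAlgebra.single m (algebraMap ℂ ℂ[T;T⁻¹] r) :=
  AddMonoidAlgebra.map_single _ _ _

lemma inclZ_var_injective : Function.Injective fun i : Fin n => inclZ n (var i) := by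
  intro i j h
  simp only [var, mono, inclZ_single, map_one] at h
  have := congrFun ((AddMonoidAlgebra.single_left_inj one_ne_zero).1 h) i
  by_contra hij
  simp [hij] at this

-- Applied to the coefficients of `∏ (X - x_i)`, the relations make the `γ` roots of `∏ (X - z_i)`,
-- so `eq_zero_of_mem_adjoin_roots` applies to the quotient.
open Polynomial in
lemma mem_fullIdeal_of_evalFull_eq_zero (e : Fin n ≃ GammaIdx lam) (x : PreFull n lam)
    (hx : ∀ w, evalFull w x = 0) : x ∈ fullIdeal n lam := by
  let Q := PreFull n lam ⧸ fullIdeal n lam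
  let mk : PreFull n lam →ₐ[KPt n] Q := Ideal.Quotient.mkₐ (KPt n) (fullIdeal n lam)
  let α : Laurent (GammaIdx lam) →+* Q := (mk : PreFull n lam →+* Q).comp PreFull.inclGamma
  let γ : Fin n → Q := fun i => α (var (e i))
  let z : Fin n → KPt n := fun i => inclZ n (var i)
  have hsym : ∀ f ∈ invariants (⊤ : Subgroup (Equiv.Perm (Fin n))),
      α (rename e f) = algebraMap (KPt n) Q (inclZ n f) := by
    intro f hf
    refine Ideal.Quotient.eq.2 (Ideal.subset_span ⟨e, ⟨f, hf⟩, rfl⟩)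
  have hrel : ∏ i, (X - C (γ i)) = (∏ i, (X - C (z i))).map (algebraMap (KPt n) Q) := by
    let F : (Laurent (Fin n))[X] := ∏ i, (X - C (var i))
    have h1 : F.map (α.comp (rename e : Laurent (Fin n) →+* Laurent (GammaIdx lam))) =
        ∏ i, (X - C (γ i)) := by
      simp only [F, Polynomial.map_prod, Polynomial.map_sub, map_X, map_C]
      refine Finset.prod_congr rfl fun i _ => ?_
      rw [RingHom.comp_apply, RingHom.coe_coe, rename_var]
    have h2 : F.map (inclZ n : Laurent (Fin n) →+* KPt n) = ∏ i, (X - C (z i)) := by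
      simp only [F, Polynomial.map_prod, Polynomial.map_sub, map_X, map_C]
      rfl
    rw [← h1, ← h2, Polynomial.map_map]
    ext j
    rw [coeff_map, coeff_map]
    refine hsym _ fun g _ => ?_
    have h3 : F.map (rename g : Laurent (Fin n) →+* Laurent (Fin n)) = F := by
      simp only [F, Polynomial.map_prod, Polynomial.map_sub, map_X, map_C, RingHom.coe_coe,
        rename_var]
      exact Equiv.prod_comp g fun i => (X - C (var i) : (Laurent (Fin n))[X])
    conv_rhs => rw [← h3, coeff_map]
    rfl
  let ev : Equiv.Perm (Fin n) → Q →ₐ[KPt n] KPt n := fun w =>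
    Ideal.Quotient.liftₐ (fullIdeal n lam) (evalFull (e.symm.trans w)) (evalFull_fullIdeal _)
  have hev : ∀ w p, ev w (mk p) = evalFull (e.symm.trans w) p := fun w p => rfl
  have hall : ∀ p, mk p ∈ Algebra.adjoin (KPt n) (Set.range γ) := by
    intro p
    induction p using PreFull.induction with
    | zero => rw [map_zero]; exact Subalgebra.zero_mem _
    | add p q hp hq => rw [map_add]; exact Subalgebra.add_mem _ hp hq
    | tmul p f =>
      have h : mk (PreFull.tmul p f) = algebraMap (KPt n) Q p * α f := by
        rw [← mk.commutes, PreFull.algebraMap_apply]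
        change _ = mk _ * mk (PreFull.tmul 1 f)
        rw [← map_mul, PreFull.tmul_mul_tmul, mul_one, one_mul]
      rw [h]
      refine Subalgebra.mul_mem _ (Subalgebra.algebraMap_mem _ p) ?_
      refine mem_of_var_mem α (Algebra.adjoin (KPt n) (Set.range γ)).toSubring
        (fun r => ?_) (fun i => ?_) ?_ f
      · change mk _ ∈ Algebra.adjoin (KPt n) (Set.range γ)
        rw [PreFull.inclGamma_algebraMap, mk.commutes]
        exact Subalgebra.algebraMap_mem _ _
      · exact Algebra.subset_adjoin ⟨e.symm i, by simp [γ]⟩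
      · have := hsym _ (mono_const_mem_invariants (ι := Fin n) ⊤ (-1))
        rw [rename_mono] at this
        change α (mono ((fun _ => -1) ∘ e.symm)) ∈ Algebra.adjoin (KPt n) (Set.range γ)
        rw [this]
        exact Subalgebra.algebraMap_mem _ _
  refine Ideal.Quotient.eq_zero_iff_mem.1 (eq_zero_of_mem_adjoin_roots γ z inclZ_var_injective
    hrel ev (fun w i => ?_) n le_rfl (mk x) ?_ fun w => ?_)
  · change ev w (mk _) = _
    rw [hev]
    refine (evalFull_tmul _ _ _).trans ?_
    rw [one_mul, rename_var]
    simp [z]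
  · have him : γ '' {i | (i : ℕ) < n} = Set.range γ := by
      ext y
      simp
    rw [him]
    exact hall x
  · rw [hev, hx]

/-- The inclusion of the invariants. -/
def toFull : PreKT n lam →+ PreFull n lam :=
  (TensorProduct.lift ((TensorProduct.mk ℂ (KPt n) (Laurent (GammaIdx lam))).flip.comp
      (invariants (blockPerms lam)).val.toLinearMap)).toAddMonoidHom

lemma toFull_tmul (g : invariants (blockPerms lam)) (p : KPt n) :
    toFull (PreKT.tmul g p) = PreFull.tmul p g.1 := rfl

/-- The averaging map onto the invariants. -/
def fromFull : PreFull n lam →+ PreKT n lam :=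
  (TensorProduct.lift ((TensorProduct.mk ℂ (invariants (blockPerms lam)) (KPt n)).flip.compl₂
      ((average (blockPerms lam)).codRestrict (Subalgebra.toSubmodule (invariants (blockPerms lam)))
        (average_mem _)))).toAddMonoidHom

lemma fromFull_tmul (p : KPt n) (f : Laurent (GammaIdx lam)) :
    fromFull (PreFull.tmul p f) =
      PreKT.tmul ⟨average (blockPerms lam) f, average_mem _ f⟩ p := rfl

lemma PreKT.tmul_mul_tmul (g g' : invariants (blockPerms lam)) (p p' : KPt n) :
    PreKT.tmul g p * PreKT.tmul g' p' = PreKT.tmul (g * g') (p * p') :=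
  Algebra.TensorProduct.tmul_mul_tmul _ _ _ _

lemma fromFull_toFull (x : PreKT n lam) : fromFull (toFull x) = x := by
  induction x using PreKT.induction with
  | zero => rw [map_zero, map_zero]
  | add x y hx hy => rw [map_add, map_add, hx, hy]
  | tmul g p =>
    rw [toFull_tmul, fromFull_tmul]
    congr 1
    exact Subtype.ext (average_of_invariant _ _ g.2)

/-- Averaging is linear over the invariants, and the generators of the ideal are invariant. -/
lemma fromFull_mem_relIdeal (x : PreFull n lam) (hx : x ∈ fullIdeal n lam) :
    fromFull x ∈ relIdeal n lam := by
  induction hx using Submodule.closure_induction with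
  | zero => rw [map_zero]; exact Ideal.zero_mem _
  | add x y _ _ hx hy => rw [map_add]; exact Ideal.add_mem _ hx hy
  | smul_mem a x hx =>
    obtain ⟨e, f, rfl⟩ := hx
    rw [smul_eq_mul]
    induction a using PreFull.induction with
    | zero => rw [zero_mul, map_zero]; exact Ideal.zero_mem _
    | add a b ha hb => rw [add_mul, map_add]; exact Ideal.add_mem _ ha hb
    | tmul p g =>
      have h := rename_mem_invariants (lam := lam) e f
      have hx : fromFull (PreFull.tmul p g *
          (PreFull.tmul 1 (rename e f.1) - PreFull.tmul (inclZ n f.1) 1)) =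
          PreKT.tmul ⟨average (blockPerms lam) g, average_mem _ g⟩ p *
            (PreKT.tmul ⟨rename e f.1, h⟩ 1 - PreKT.tmul 1 (inclZ n f.1)) := by
        rw [mul_sub, map_sub, PreFull.tmul_mul_tmul, PreFull.tmul_mul_tmul, fromFull_tmul,
          fromFull_tmul, mul_sub, PreKT.tmul_mul_tmul, PreKT.tmul_mul_tmul, mul_one, mul_one,
          mul_one]
        congr 2
        exact Subtype.ext (average_mul_of_invariant _ _ _ h)
      rw [hx]
      exact Ideal.mul_mem_left _ _ (Ideal.subset_span ⟨e, f, rfl⟩)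

lemma evalFull_toFull (J : FlagIndex n lam) (w : GammaIdx lam ≃ Fin n)
    (hw : ∀ x, J.block (w x) = x.1) (x : PreKT n lam) : evalFull w (toFull x) = J.preLoc x := by
  induction x using PreKT.induction with
  | zero => simp
  | add x y hx hy => rw [map_add, map_add, map_add, hx, hy]
  | tmul g p => rw [toFull_tmul, evalFull_tmul, J.preLoc_tmul, J.rename_listing g w hw, mul_comm]

/-- The partition with `I_k = w({k} × {1, …, λ_k})`. -/
def FlagIndex.ofEquiv (w : GammaIdx lam ≃ Fin n) : FlagIndex n lam where
  block a := (w.symm a).1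
  card_block k := by
    rw [← Fintype.card_fin (lam k),
      ← Fintype.card_congr (Equiv.sigmaSubtype (β := fun i => Fin (lam i)) k)]
    exact Fintype.card_congr (w.symm.subtypeEquiv fun _ => Iff.rfl)

/-- Localization at the fixed points is injective. -/
lemma eq_of_loc_eq (e : Fin n ≃ GammaIdx lam) (κ κ' : KT n lam)
    (h : ∀ J : FlagIndex n lam, J.loc κ = J.loc κ') : κ = κ' := by
  obtain ⟨x, rfl⟩ := Ideal.Quotient.mk_surjective κ
  obtain ⟨y, rfl⟩ := Ideal.Quotient.mk_surjective κ'
  refine Ideal.Quotient.eq.2 ?_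
  rw [← fromFull_toFull (x - y)]
  refine fromFull_mem_relIdeal _ (mem_fullIdeal_of_evalFull_eq_zero e _ fun w => ?_)
  rw [evalFull_toFull (FlagIndex.ofEquiv w) w (fun x => by simp [FlagIndex.ofEquiv]), map_sub,
    sub_eq_zero]
  exact h _

end Splitting

/-! ### The classes at fixed points and their degrees. -/

section FixedPointClasses

variable {N n : ℕ} {lam : Fin N → ℕ}

namespace FlagIndex

/-- The pairs `(a, b)` with `a ∈ J_k`, `b ∈ J_l` and `k < l`. -/
def pairs (J : FlagIndex n lam) : Finset (Fin n × Fin n) :=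
  Finset.univ.filter fun p => J.block p.1 < J.block p.2

lemma mem_pairs (J : FlagIndex n lam) (p : Fin n × Fin n) :
    p ∈ J.pairs ↔ J.block p.1 < J.block p.2 := by
  simp [pairs]

lemma ne_of_mem_pairs {J : FlagIndex n lam} {p : Fin n × Fin n} (hp : p ∈ J.pairs) :
    p.1 ≠ p.2 := fun h => by
  rw [mem_pairs, h] at hp
  exact lt_irrefl _ hp

/-- The linear map `φ_J` on integral exponents. -/
def deg (J : FlagIndex n lam) : (Fin n → ℤ) →+ ℤ where
  toFun m := ∑ a, (((J.block a : ℕ) : ℤ) + 1) * m a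
  map_zero' := by simp
  map_add' m m' := by simp [mul_add, Finset.sum_add_distrib]

lemma deg_apply (J : FlagIndex n lam) (m : Fin n → ℤ) :
    J.deg m = ∑ a, (((J.block a : ℕ) : ℤ) + 1) * m a := rfl

lemma deg_rootVec (J : FlagIndex n lam) (a b : Fin n) :
    J.deg (rootVec a b) = ((J.block b : ℕ) : ℤ) - ((J.block a : ℕ) : ℤ) := by
  simp [deg_apply, rootVec, mul_sub, Finset.sum_sub_distrib, Pi.single_apply]

lemma deg_rootVec_pos {J : FlagIndex n lam} {p : Fin n × Fin n} (hp : p ∈ J.pairs) :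
    0 < J.deg (rootVec p.1 p.2) := by
  rw [mem_pairs, Fin.lt_def] at hp
  rw [deg_rootVec]
  omega

lemma deg_comp_permExp (J : FlagIndex n lam) (τ : Equiv.Perm (Fin n)) :
    J.deg.comp (permExp τ) = (J.comapPerm τ).deg := by
  refine AddMonoidHom.ext fun m => ?_
  rw [AddMonoidHom.comp_apply, deg_apply, deg_apply, ← Equiv.sum_comp τ]
  simp [permExp]

lemma sum_block {A : Type*} [CommRing A] (J : FlagIndex n lam) (g : Fin N → A) :
    ∑ a, g (J.block a) = ∑ k, (lam k : A) * g k := by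
  rw [← Finset.sum_fiberwise Finset.univ J.block]
  refine Finset.sum_congr rfl fun k _ => ?_
  rw [Finset.sum_congr rfl (g := fun _ => g k) fun a ha => by rw [(Finset.mem_filter.1 ha).2],
    Finset.sum_const, nsmul_eq_mul, ← J.card_block k, Fintype.card_subtype]

end FlagIndex

/-- The number `∑_{k < l} λ_k λ_l (l - k)` as an integer. -/
def intWidth (lam : Fin N → ℕ) : ℤ :=
  ∑ k : Fin N, ∑ l ∈ Finset.univ.filter (fun l => k < l),
    (lam k : ℤ) * (lam l : ℤ) * (((l : ℕ) : ℤ) - ((k : ℕ) : ℤ))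

lemma cast_intWidth (lam : Fin N → ℕ) : ((intWidth lam : ℤ) : ℝ) = width lam := by
  simp [intWidth, width]

lemma FlagIndex.sum_deg_rootVec (J : FlagIndex n lam) :
    ∑ p ∈ J.pairs, J.deg (rootVec p.1 p.2) = intWidth lam := by
  simp only [FlagIndex.deg_rootVec, FlagIndex.pairs, intWidth, Finset.sum_filter]
  rw [Fintype.sum_prod_type]
  have h1 : ∀ a : Fin n, (∑ b : Fin n, if J.block a < J.block b then
      ((J.block b : ℕ) : ℤ) - ((J.block a : ℕ) : ℤ) else 0) =
      ∑ l, (lam l : ℤ) * if J.block a < l then ((l : ℕ) : ℤ) - ((J.block a : ℕ) : ℤ) else 0 :=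
    fun a => J.sum_block fun l => if J.block a < l then ((l : ℕ) : ℤ) - ((J.block a : ℕ) : ℤ) else 0
  simp only [h1]
  rw [J.sum_block fun k => ∑ l, (lam l : ℤ) * if k < l then ((l : ℕ) : ℤ) - ((k : ℕ) : ℤ) else 0]
  refine Finset.sum_congr rfl fun k _ => ?_
  rw [Finset.mul_sum]
  refine Finset.sum_congr rfl fun l _ => ?_
  split_ifs <;> ring

/-- An interval is convex, so only the exponents themselves need checking, and there `φ_J` takes
integer values. -/
lemma isSmall_iff (J : FlagIndex n lam) (f : KPt n) :
    IsSmall J f ↔ SuppIn J.deg 0 (intWidth lam - 1) f := by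
  have hphi : ∀ m : Fin n → ℤ, phi J (fun a => (m a : ℝ)) = (J.deg m : ℝ) := fun m => by
    simp [phi, FlagIndex.deg_apply]
  have hmem : ∀ m : Fin n → ℤ, phi J (fun a => (m a : ℝ)) ∈ Set.Icc 0 (width lam - 1) ↔
      0 ≤ J.deg m ∧ J.deg m ≤ intWidth lam - 1 := fun m => by
    rw [hphi, ← cast_intWidth, Set.mem_Icc]
    norm_cast
  rw [IsSmall, newtonPolygon, LinearMap.image_convexHull,
    (convex_Icc _ _).convexHull_subset_iff]
  constructor
  · intro h m hm
    exact (hmem m).1 (h ⟨_, ⟨m, hm, rfl⟩, rfl⟩)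
  · rintro h _ ⟨_, ⟨m, hm, rfl⟩, rfl⟩
    exact (hmem m).2 (h m hm)

/-- The coefficient of the binomial for the pair `(a, b)` in the class of a fixed point. -/
def pairCoeff (p : Fin n × Fin n) : ℂ[T;T⁻¹] := if p.1 < p.2 then 1 else LaurentPolynomial.T 1

lemma pairCoeff_ne_zero (p : Fin n × Fin n) : pairCoeff p ≠ 0 := by
  rw [pairCoeff]
  split_ifs
  exacts [one_ne_zero, T_ne_zero]

namespace FlagIndex

/-- The product `P_{id,J} e_{id,J}`. -/
def fixClass (J : FlagIndex n lam) : KPt n :=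
  ∏ p ∈ J.pairs, oneSub (pairCoeff p) (rootVec p.1 p.2)

/-- The product `e^{vert}_{id,J,-}`. -/
def vertClass (J : FlagIndex n lam) : KPt n :=
  ∏ p ∈ J.pairs.filter fun p => p.2 < p.1, oneSub (LaurentPolynomial.T 1) (rootVec p.1 p.2)

/-- The product of `1 - z_b/z_a` over the pairs with `a < b`. -/
def horClass (J : FlagIndex n lam) : KPt n :=
  ∏ p ∈ J.pairs.filter fun p => p.1 < p.2, oneSub 1 (rootVec p.1 p.2)

lemma horClass_mul_vertClass (J : FlagIndex n lam) :
    J.horClass * J.vertClass = J.fixClass := by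
  rw [fixClass, ← Finset.prod_filter_mul_prod_filter_not J.pairs fun p => p.1 < p.2]
  congr 1
  · refine Finset.prod_congr rfl fun p hp => ?_
    rw [pairCoeff, if_pos (Finset.mem_filter.1 hp).2]
  · refine Finset.prod_congr ?_ fun p hp => ?_
    · refine Finset.filter_congr fun p hp => ?_
      rw [not_lt]
      exact ⟨le_of_lt, fun h => lt_of_le_of_ne h (ne_of_mem_pairs hp).symm⟩
    · rw [pairCoeff, if_neg (Finset.mem_filter.1 hp).2]

lemma suppIn_fixClass (J : FlagIndex n lam) : SuppIn J.deg 0 (intWidth lam) J.fixClass := by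
  rw [← J.sum_deg_rootVec]
  exact SuppIn.prod_oneSub _ _ _ fun p hp => (deg_rootVec_pos hp).le

end FlagIndex

lemma pairProd_eq (r : Fin n → Fin n → Prop) [DecidableRel r] (F : Fin n → Fin n → KPt n)
    (σ : Equiv.Perm (Fin n)) (J : FlagIndex n lam) :
    pairProd r F σ J =
      ∏ p ∈ (J.comapPerm σ).pairs.filter (fun p => r p.2 p.1), F (σ p.2) (σ p.1) := by
  simp only [pairProd, Finset.prod_sigma']
  refine Finset.prod_nbij' (fun x => (x.2.2.1, x.2.2.2))
    (fun p => ⟨J.block (σ p.1), J.block (σ p.2), p.1, p.2⟩) ?_ ?_ ?_ ?_ ?_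
  · rintro ⟨k, l, a, b⟩ h
    simp only [FlagIndex.part, Finset.mem_sigma, Finset.mem_filter, Finset.mem_univ,
      true_and] at h
    obtain ⟨h1, h2, h3, h4⟩ := h
    rw [Finset.mem_filter, FlagIndex.mem_pairs]
    exact ⟨by simpa [h2, h3] using h1, h4⟩
  · rintro ⟨a, b⟩ h
    rw [Finset.mem_filter, FlagIndex.mem_pairs] at h
    simp only [FlagIndex.part, Finset.mem_sigma, Finset.mem_filter, Finset.mem_univ,
      true_and]
    exact h
  · rintro ⟨k, l, a, b⟩ h
    simp only [FlagIndex.part, Finset.mem_sigma, Finset.mem_filter, Finset.mem_univ,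
      true_and] at h
    obtain ⟨h1, rfl, rfl, h4⟩ := h
    rfl
  · rintro ⟨a, b⟩ _
    rfl
  · rintro ⟨k, l, a, b⟩ _
    rfl

lemma eVertMinus_eq (σ : Equiv.Perm (Fin n)) (J : FlagIndex n lam) :
    eVertMinus σ J = permMap σ (J.comapPerm σ).vertClass := by
  rw [eVertMinus, pairProd_eq, FlagIndex.vertClass, map_prod]
  refine Finset.prod_congr rfl fun p _ => ?_
  rw [one_sub_hvar_mul_zratio, permMap_oneSub_rootVec]

lemma zratio_mul_zratio (a b : Fin n) : zratio b a * zratio a b = 1 := by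
  rw [zratio, zratio, AddMonoidAlgebra.single_mul_single, sub_add_sub_cancel, sub_self, one_mul]
  rfl

/-- The polarization reverses each horizontal factor, so that it has positive degree like the
vertical ones. -/
lemma neg_zratio_mul (a b : Fin n) :
    -zratio b a * (1 - zratio a b) = oneSub 1 (rootVec a b) := by
  rw [← one_sub_zratio]
  linear_combination zratio_mul_zratio a b

lemma polarization_mul_eClass (σ : Equiv.Perm (Fin n)) (J : FlagIndex n lam) :
    polarization σ J * eClass σ J = permMap σ (J.comapPerm σ).fixClass := by
  rw [eClass, ← mul_assoc, eVertMinus_eq, ← FlagIndex.horClass_mul_vertClass, map_mul]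
  congr 1
  rw [polarization, eHorMinus, pairProd_eq, pairProd_eq, ← Finset.prod_mul_distrib,
    FlagIndex.horClass, map_prod]
  refine Finset.prod_congr rfl fun p _ => ?_
  rw [neg_zratio_mul, permMap_oneSub_rootVec]

lemma isSmall_permMap_iff (τ : Equiv.Perm (Fin n)) (J : FlagIndex n lam) (f : KPt n) :
    IsSmall J (permMap τ f) ↔ SuppIn (J.comapPerm τ).deg 0 (intWidth lam - 1) f := by
  rw [isSmall_iff, ← J.deg_comp_permExp]
  refine ⟨fun h => ?_, fun h => h.expMap⟩
  have h2 := SuppIn.expMap (φ := J.deg.comp (permExp τ)) (permExp τ.symm) (f := permMap τ f) (by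
    have : (J.deg.comp (permExp τ)).comp (permExp τ.symm) = J.deg := by
      refine AddMonoidHom.ext fun m => ?_
      simp [permExp, Function.comp_assoc]
    rwa [this])
  have h3 := permMap_permMap_symm τ.symm f
  rw [Equiv.symm_symm] at h3
  rwa [← h3]

end FixedPointClasses

/-! ### Uniqueness by the width of the Newton polygon. -/

section Uniqueness

variable {N n : ℕ} {lam : Fin N → ℕ}

namespace FlagIndex

/-- A statistic that drops when the entries of a pair `a < b` with `J(a) < J(b)` are exchanged. -/
def weight (J : FlagIndex n lam) : ℕ := ∑ a : Fin n, (a : ℕ) * (J.block a : ℕ)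

lemma weight_comapPerm_swap_lt (J : FlagIndex n lam) {a b : Fin n} (hab : a < b)
    (hJ : J.block a < J.block b) : (J.comapPerm (Equiv.swap a b)).weight < J.weight := by
  have hsplit : ∀ K : FlagIndex n lam, K.weight = (a : ℕ) * (K.block a : ℕ) +
      ((b : ℕ) * (K.block b : ℕ) +
        ∑ c ∈ (Finset.univ.erase a).erase b, (c : ℕ) * (K.block c : ℕ)) := fun K => by
    rw [Finset.add_sum_erase _ (fun c : Fin n => (c : ℕ) * (K.block c : ℕ))
      (Finset.mem_erase.2 ⟨hab.ne', Finset.mem_univ b⟩),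
      Finset.add_sum_erase _ (fun c : Fin n => (c : ℕ) * (K.block c : ℕ)) (Finset.mem_univ a)]
    rfl
  rw [hsplit, hsplit J]
  have hrest : ∑ c ∈ (Finset.univ.erase a).erase b,
      (c : ℕ) * ((J.comapPerm (Equiv.swap a b)).block c : ℕ) =
      ∑ c ∈ (Finset.univ.erase a).erase b, (c : ℕ) * (J.block c : ℕ) := by
    refine Finset.sum_congr rfl fun c hc => ?_
    simp only [Finset.mem_erase] at hc
    rw [comapPerm_block, Equiv.swap_apply_of_ne_of_ne hc.2.1 hc.1]
  rw [hrest, comapPerm_block, comapPerm_block, Equiv.swap_apply_left, Equiv.swap_apply_right]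
  rw [Fin.lt_def] at hab hJ
  nlinarith

/-- The horizontal binomials are adjoined to the vertical class one at a time; each is prime and
divides none of the factors already collected. -/
lemma fixClass_dvd (J : FlagIndex n lam) (f : KPt n) (hv : J.vertClass ∣ f)
    (hf : ∀ p ∈ J.pairs, p.1 < p.2 → oneSub 1 (rootVec p.1 p.2) ∣ f) : J.fixClass ∣ f := by
  rw [← horClass_mul_vertClass, mul_comm, horClass]
  have key : ∀ U ⊆ J.pairs.filter fun p => p.1 < p.2,
      J.vertClass * ∏ p ∈ U, oneSub 1 (rootVec p.1 p.2) ∣ f := by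
    intro U
    induction U using Finset.induction_on with
    | empty => intro _; simpa using hv
    | insert p U hp ih =>
      intro hU
      have hpm := Finset.mem_filter.1 (hU (Finset.mem_insert_self p U))
      have hne := ne_of_mem_pairs hpm.1
      rw [Finset.prod_insert hp, mul_comm (oneSub _ _), ← mul_assoc]
      refine mul_dvd_of_dvd hne ?_ (hf p hpm.1 hpm.2)
        (ih ((Finset.subset_insert p U).trans hU))
      -- After identifying the two variables, a vertical factor stays nonzero because of `h`, and
      -- another horizontal factor because its exponent stays nonzero. The reversed pair cannot
      -- occur, since all pairs in `U` are increasing.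
      rw [map_mul, vertClass, map_prod, map_prod]
      refine mul_ne_zero (Finset.prod_ne_zero_iff.2 fun q _ h => ?_)
        (Finset.prod_ne_zero_iff.2 fun q hq h => ?_)
      · rw [expMap_oneSub, oneSub_eq_zero_iff] at h
        exact T_ne_one h.2
      · rw [expMap_oneSub, oneSub_eq_zero_iff] at h
        have hqm := Finset.mem_filter.1 (hU (Finset.mem_insert_of_mem hq))
        refine mergeExp_rootVec_ne_zero (ne_of_mem_pairs hqm.1) ?_ ?_ h.1
        · rintro h'
          exact hp ((show q = p from h') ▸ hq)
        · intro h'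
          have h1 := congrArg Prod.fst h'
          have h2 := congrArg Prod.snd h'
          have := hqm.2
          rw [show q.1 = p.2 from h1, show q.2 = p.1 from h2] at this
          exact lt_asymm this hpm.2
  exact key _ subset_rfl

/-- Dividing by `fixClass` lowers the upper bound by its full degree, which leaves the empty strip
`[0, -1]` for the quotient. -/
lemma eq_zero_of_fixClass_dvd (J : FlagIndex n lam) (f : KPt n) (hf : J.fixClass ∣ f)
    (hs : SuppIn J.deg 0 (intWidth lam - 1) f) : f = 0 := by
  obtain ⟨g, rfl⟩ := hf
  have hg : SuppIn J.deg 0 (-1) g := by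
    refine SuppIn.of_prod_oneSub_mul J.pairs pairCoeff (fun p => rootVec p.1 p.2)
      (fun p _ => pairCoeff_ne_zero p) (fun p hp => rootVec_ne_zero (ne_of_mem_pairs hp))
      (fun p hp => (deg_rootVec_pos hp).le) ?_
    rw [J.sum_deg_rootVec]
    exact hs.mono le_rfl (by omega)
  rw [eq_zero_of_suppIn hg (by omega), mul_zero]

end FlagIndex

/-- A class that vanishes at `x_I`, is divisible by the vertical classes and is small away from `I`
vanishes at all fixed points. -/
lemma loc_eq_zero_of_small (I : FlagIndex n lam) (κ : KT n lam) (hI : I.loc κ = 0)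
    (hv : ∀ J : FlagIndex n lam, J.vertClass ∣ J.loc κ)
    (hs : ∀ J : FlagIndex n lam, J ≠ I → SuppIn J.deg 0 (intWidth lam - 1) (J.loc κ))
    (J : FlagIndex n lam) : J.loc κ = 0 := by
  induction h : J.weight using Nat.strong_induction_on generalizing J with
  | _ w ih =>
    subst h
    by_cases hJ : J = I
    · rw [hJ, hI]
    · refine J.eq_zero_of_fixClass_dvd _ (J.fixClass_dvd _ (hv J) fun p hp hlt => ?_) (hs J hJ)
      have h0 := ih _ (J.weight_comapPerm_swap_lt hlt ((J.mem_pairs p).1 hp)) _ rfl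
      have := oneSub_dvd_loc_sub_loc hlt.ne κ J
      rwa [h0, sub_zero] at this

end Uniqueness

/-! ### The effect of an adjacent transposition on pairs and inversions. -/

section AdjacentSwap

variable {N n : ℕ} {lam : Fin N → ℕ}

/-- Nothing lies strictly between `a` and `b`, so only their own order is reversed. All factors of
other pairs are thereby permuted with their type preserved. -/
lemma swap_lt_swap_iff {a b : Fin n} (hab : (b : ℕ) = a + 1) {c d : Fin n}
    (h1 : (c, d) ≠ (a, b)) (h2 : (c, d) ≠ (b, a)) :
    Equiv.swap a b c < Equiv.swap a b d ↔ c < d := by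
  simp only [ne_eq, Prod.mk.injEq, Fin.ext_iff] at h1 h2
  simp only [Equiv.swap_apply_def, Fin.lt_def, Fin.ext_iff]
  split_ifs <;> omega

namespace FlagIndex

lemma comapPerm_swap_comapPerm_swap (J : FlagIndex n lam) (a b : Fin n) :
    (J.comapPerm (Equiv.swap a b)).comapPerm (Equiv.swap a b) = J :=
  block_injective (funext fun c => by simp)

/-- The pairs of `J` other than `(a, b)` and `(b, a)`. -/
def restPairs (J : FlagIndex n lam) (a b : Fin n) : Finset (Fin n × Fin n) :=
  J.pairs.filter fun p => p ≠ (a, b) ∧ p ≠ (b, a)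

lemma mem_restPairs {J : FlagIndex n lam} {a b : Fin n} {p : Fin n × Fin n} :
    p ∈ J.restPairs a b ↔ J.block p.1 < J.block p.2 ∧ p ≠ (a, b) ∧ p ≠ (b, a) := by
  rw [restPairs, Finset.mem_filter, mem_pairs]

lemma pairs_of_lt {J : FlagIndex n lam} {a b : Fin n} (h : J.block a < J.block b) :
    J.pairs = insert (a, b) (J.restPairs a b) := by
  ext ⟨c, d⟩
  rw [Finset.mem_insert, mem_restPairs, mem_pairs]
  constructor
  · intro hcd
    by_cases h1 : (c, d) = (a, b)
    · exact Or.inl h1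
    · refine Or.inr ⟨hcd, h1, fun h2 => ?_⟩
      obtain ⟨rfl, rfl⟩ := Prod.mk.inj h2
      exact lt_asymm h hcd
  · rintro (h1 | h1)
    · obtain ⟨rfl, rfl⟩ := Prod.mk.inj h1
      exact h
    · exact h1.1

lemma pairs_of_gt {J : FlagIndex n lam} {a b : Fin n} (h : J.block b < J.block a) :
    J.pairs = insert (b, a) (J.restPairs a b) := by
  rw [pairs_of_lt h, restPairs, restPairs]
  congr 2
  ext p
  exact and_comm

lemma pairs_of_eq {J : FlagIndex n lam} {a b : Fin n} (h : J.block a = J.block b) :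
    J.pairs = J.restPairs a b := by
  ext ⟨c, d⟩
  rw [mem_restPairs, mem_pairs]
  refine ⟨fun hcd => ⟨hcd, ?_, ?_⟩, fun h => h.1⟩
  all_goals
    rintro h1
    obtain ⟨rfl, rfl⟩ := Prod.mk.inj h1
    simp [h] at hcd

lemma notMem_restPairs_left (J : FlagIndex n lam) (a b : Fin n) : (a, b) ∉ J.restPairs a b := by
  simp [mem_restPairs]

lemma notMem_restPairs_right (J : FlagIndex n lam) (a b : Fin n) : (b, a) ∉ J.restPairs a b := by
  simp [mem_restPairs]

lemma swap_mem_restPairs {J : FlagIndex n lam} {a b : Fin n} {p : Fin n × Fin n}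
    (hp : p ∈ (J.comapPerm (Equiv.swap a b)).restPairs a b) :
    (Equiv.swap a b p.1, Equiv.swap a b p.2) ∈ J.restPairs a b := by
  rw [mem_restPairs] at hp ⊢
  refine ⟨hp.1, fun h => hp.2.2 ?_, fun h => hp.2.1 ?_⟩
  all_goals
    obtain ⟨h1, h2⟩ := Prod.mk.inj h
    rw [Equiv.swap_apply_eq_iff] at h1 h2
    ext <;> simp [h1, h2]

lemma prod_restPairs {M : Type*} [CommMonoid M] (J : FlagIndex n lam) (a b : Fin n)
    (G : Fin n × Fin n → M) :
    ∏ p ∈ (J.comapPerm (Equiv.swap a b)).restPairs a b,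
      G (Equiv.swap a b p.1, Equiv.swap a b p.2) = ∏ p ∈ J.restPairs a b, G p := by
  refine Finset.prod_nbij' (fun p => (Equiv.swap a b p.1, Equiv.swap a b p.2))
    (fun p => (Equiv.swap a b p.1, Equiv.swap a b p.2)) (fun p hp => swap_mem_restPairs hp)
    (fun p hp => swap_mem_restPairs ?_) (fun p _ => ?_) (fun p _ => ?_) (fun p _ => rfl)
  · rwa [comapPerm_swap_comapPerm_swap]
  · simp
  · simp

lemma permMap_prod_restPairs (J : FlagIndex n lam) (a b : Fin n) (G : Fin n × Fin n → KPt n)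
    (hG : ∀ p, p ≠ (a, b) → p ≠ (b, a) →
      permMap (Equiv.swap a b) (G p) = G (Equiv.swap a b p.1, Equiv.swap a b p.2)) :
    permMap (Equiv.swap a b) (∏ p ∈ (J.comapPerm (Equiv.swap a b)).restPairs a b, G p) =
      ∏ p ∈ J.restPairs a b, G p := by
  rw [map_prod, ← prod_restPairs J a b]
  refine Finset.prod_congr rfl fun p hp => ?_
  rw [mem_restPairs] at hp
  exact hG p hp.2.1 hp.2.2

/-- The factor of the pair `p` in the vertical class. -/
def vertFactor (p : Fin n × Fin n) : KPt n :=
  if p.2 < p.1 then oneSub (LaurentPolynomial.T 1) (rootVec p.1 p.2) else 1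

lemma vertClass_eq (J : FlagIndex n lam) : J.vertClass = ∏ p ∈ J.pairs, vertFactor p := by
  rw [vertClass, Finset.prod_filter]
  rfl

lemma permMap_prod_vertFactor (J : FlagIndex n lam) {a b : Fin n} (hab : (b : ℕ) = a + 1) :
    permMap (Equiv.swap a b)
      (∏ p ∈ (J.comapPerm (Equiv.swap a b)).restPairs a b, vertFactor p) =
      ∏ p ∈ J.restPairs a b, vertFactor p := by
  refine J.permMap_prod_restPairs a b _ fun p h1 h2 => ?_
  have h : Equiv.swap a b p.2 < Equiv.swap a b p.1 ↔ p.2 < p.1 :=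
    swap_lt_swap_iff hab (fun h => h2 (by rw [← Prod.swap_inj]; exact h))
      (fun h => h1 (by rw [← Prod.swap_inj]; exact h))
  simp only [vertFactor, h]
  split_ifs
  · rw [permMap_oneSub_rootVec]
  · rw [map_one]

lemma permMap_prod_fixFactor (J : FlagIndex n lam) {a b : Fin n} (hab : (b : ℕ) = a + 1) :
    permMap (Equiv.swap a b) (∏ p ∈ (J.comapPerm (Equiv.swap a b)).restPairs a b,
      oneSub (pairCoeff p) (rootVec p.1 p.2)) =
      ∏ p ∈ J.restPairs a b, oneSub (pairCoeff p) (rootVec p.1 p.2) := by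
  refine J.permMap_prod_restPairs a b _ fun p h1 h2 => ?_
  have h : Equiv.swap a b p.1 < Equiv.swap a b p.2 ↔ p.1 < p.2 := swap_lt_swap_iff hab h1 h2
  rw [permMap_oneSub_rootVec]
  simp only [pairCoeff, h]

/-- The number of inversions. -/
def inv (J : FlagIndex n lam) : ℕ := ∑ p ∈ J.pairs, if p.2 < p.1 then 1 else 0

lemma sum_restPairs_inv (J : FlagIndex n lam) {a b : Fin n} (hab : (b : ℕ) = a + 1) :
    ∑ p ∈ (J.comapPerm (Equiv.swap a b)).restPairs a b, (if p.2 < p.1 then 1 else 0) =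
      ∑ p ∈ J.restPairs a b, if p.2 < p.1 then 1 else 0 := by
  -- The additive version comes from the product formula in `Multiplicative ℕ`.
  have := prod_restPairs J a b
    (fun p => Multiplicative.ofAdd (if p.2 < p.1 then 1 else 0 : ℕ))
  rw [← ofAdd_sum, ← ofAdd_sum] at this
  rw [← Multiplicative.ofAdd.injective this]
  refine Finset.sum_congr rfl fun p hp => ?_
  rw [mem_restPairs] at hp
  have h : Equiv.swap a b p.2 < Equiv.swap a b p.1 ↔ p.2 < p.1 :=
    swap_lt_swap_iff hab (fun h => hp.2.2 (by rw [← Prod.swap_inj]; exact h))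
      (fun h => hp.2.1 (by rw [← Prod.swap_inj]; exact h))
  simp only [h]

lemma inv_comapPerm_swap_of_lt (J : FlagIndex n lam) {a b : Fin n} (hab : (b : ℕ) = a + 1)
    (h : J.block a < J.block b) : (J.comapPerm (Equiv.swap a b)).inv = J.inv + 1 := by
  have h' : (J.comapPerm (Equiv.swap a b)).block b < (J.comapPerm (Equiv.swap a b)).block a := by
    simpa using h
  have hlt : a < b := by rw [Fin.lt_def]; omega
  rw [inv, inv, pairs_of_gt h', pairs_of_lt h, Finset.sum_insert (notMem_restPairs_right _ _ _),
    Finset.sum_insert (notMem_restPairs_left _ _ _), sum_restPairs_inv J hab, if_pos hlt,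
    if_neg hlt.not_gt]
  omega

lemma inv_le_inv_comapPerm_swap (J : FlagIndex n lam) {a b : Fin n} (hab : (b : ℕ) = a + 1) :
    J.inv ≤ (J.comapPerm (Equiv.swap a b)).inv + 1 := by
  rcases lt_trichotomy (J.block a) (J.block b) with h | h | h
  · have := J.inv_comapPerm_swap_of_lt hab h
    omega
  · have h' : J.comapPerm (Equiv.swap a b) = J := block_injective (funext fun c => by
      rw [comapPerm_block, Equiv.swap_apply_def]
      split_ifs with h1 h2
      · rw [h1, h]
      · rw [h2, h]
      · rfl)
    rw [h']
    omega
  · have := (J.comapPerm (Equiv.swap a b)).inv_comapPerm_swap_of_lt hab (by simpa using h)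
    rw [comapPerm_swap_comapPerm_swap] at this
    omega

end FlagIndex

end AdjacentSwap

/-! ### The inductive step: Demazure–Lusztig operators preserve stability. -/

section Existence

variable {N n : ℕ} {lam : Fin N → ℕ}

/-- The conditions on `κ_{id,I}`, with a triangularity condition. -/
structure IsStable (I : FlagIndex n lam) (κ : KT n lam) : Prop where
  vert : ∀ J : FlagIndex n lam, J.vertClass ∣ J.loc κ
  diag : I.loc κ = I.fixClass
  small : ∀ J : FlagIndex n lam, J ≠ I → SuppIn J.deg 0 (intWidth lam - 1) (J.loc κ)
  triangular : ∀ J : FlagIndex n lam, J ≠ I → J.loc κ ≠ 0 → J.inv < I.inv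

lemma suppIn_zratio_sub_hvar (φ : (Fin n → ℤ) →+ ℤ) (a b : Fin n) (h : 0 ≤ φ (rootVec a b)) :
    SuppIn φ 0 (φ (rootVec a b)) (zratio b a - hvar n) := by
  have h1 : SuppIn φ 0 0 (hvar n) := by
    have := SuppIn.single (φ := φ) (0 : Fin n → ℤ) (LaurentPolynomial.T 1)
    rwa [map_zero] at this
  exact ((SuppIn.single _ _).mono h le_rfl).sub (h1.mono le_rfl h)

lemma suppIn_one_sub_hvar (φ : (Fin n → ℤ) →+ ℤ) : SuppIn φ 0 0 (1 - hvar n) := by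
  have h1 : ∀ c, SuppIn φ 0 0 (AddMonoidAlgebra.single 0 c : KPt n) := fun c => by
    have := SuppIn.single (φ := φ) (0 : Fin n → ℤ) c
    rwa [map_zero] at this
  exact (h1 1).sub (h1 _)

lemma zratio_sub_hvar (a b : Fin n) :
    zratio b a - hvar n = zratio b a * oneSub (LaurentPolynomial.T 1) (rootVec b a) := by
  rw [← one_sub_hvar_mul_zratio]
  linear_combination hvar n * zratio_mul_zratio a b

-- Triangularity is carried along because the new diagonal value at the swapped partition must
-- receive no contribution from the old class there.
open FlagIndex in
lemma IsStable.exists_swap {I : FlagIndex n lam} {κ : KT n lam} (hκ : IsStable I κ)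
    {a b : Fin n} (hab : (b : ℕ) = a + 1) (hI : I.block a < I.block b) :
    ∃ κ', IsStable (I.comapPerm (Equiv.swap a b)) κ' := by
  have hlt : a < b := by rw [Fin.lt_def]; omega
  obtain ⟨κ', hκ'⟩ := exists_loc_demazureLusztig hlt.ne κ
  have hsI : I.comapPerm (Equiv.swap a b) ≠ I := fun h => by
    have := congrArg (fun J : FlagIndex n lam => J.block a) h
    simp only [comapPerm_block, Equiv.swap_apply_left] at this
    exact hI.ne' this
  have hinv := I.inv_comapPerm_swap_of_lt hab hI
  have hne0 : oneSub 1 (rootVec a b) ≠ 0 := fun h =>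
    rootVec_ne_zero hlt.ne ((oneSub_eq_zero_iff _ _).1 h).1
  have hsJ : ∀ J : FlagIndex n lam, J ≠ I.comapPerm (Equiv.swap a b) →
      J.comapPerm (Equiv.swap a b) ≠ I := fun J hJ h => hJ (by
    rw [← h, comapPerm_swap_comapPerm_swap])
  refine ⟨κ', ?_, ?_, ?_, ?_⟩
  · intro J
    have hdvd : J.vertClass ∣ (zratio b a - hvar n) *
        permMap (Equiv.swap a b) ((J.comapPerm (Equiv.swap a b)).loc κ) := by
      have h1 : ∏ p ∈ J.restPairs a b, vertFactor p ∣
          permMap (Equiv.swap a b) ((J.comapPerm (Equiv.swap a b)).loc κ) := by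
        rw [← J.permMap_prod_vertFactor hab]
        refine map_dvd _ (dvd_trans ?_ (hκ.vert _))
        rw [vertClass_eq]
        exact Finset.prod_dvd_prod_of_subset _ _ _ (Finset.filter_subset _ _)
      rw [vertClass_eq]
      rcases lt_trichotomy (J.block a) (J.block b) with h | h | h
      · rw [pairs_of_lt h, Finset.prod_insert (notMem_restPairs_left _ _ _), vertFactor,
          if_neg hlt.not_gt, one_mul]
        exact h1.mul_left _
      · rw [pairs_of_eq h]
        exact h1.mul_left _
      · rw [pairs_of_gt h, Finset.prod_insert (notMem_restPairs_right _ _ _), vertFactor,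
          if_pos hlt, zratio_sub_hvar]
        -- The one vertical factor missing from the transported class is supplied by `z_b/z_a - h`.
        exact mul_dvd_mul (Dvd.intro_left _ rfl) h1
    obtain ⟨g, hg⟩ : J.vertClass ∣ oneSub 1 (rootVec a b) * J.loc κ' := by
      rw [hκ' J]
      exact dvd_sub ((hκ.vert J).mul_left _) hdvd
    have hcop : expMap (mergeExp a b) J.vertClass ≠ 0 := by
      rw [vertClass, map_prod]
      refine Finset.prod_ne_zero_iff.2 fun q _ h => ?_
      rw [expMap_oneSub, oneSub_eq_zero_iff] at h
      exact T_ne_one h.2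
    obtain ⟨g', rfl⟩ := oneSub_dvd_of_dvd_mul hlt.ne hcop (Dvd.intro _ hg)
    exact ⟨g', mul_left_cancel₀ hne0 (by rw [hg]; ring)⟩
  · have h := hκ' (I.comapPerm (Equiv.swap a b))
    have h0 : (I.comapPerm (Equiv.swap a b)).loc κ = 0 := by
      by_contra h0
      have := hκ.triangular _ hsI h0
      omega
    have hI' : (I.comapPerm (Equiv.swap a b)).block b <
        (I.comapPerm (Equiv.swap a b)).block a := by simpa using hI
    rw [h0, comapPerm_swap_comapPerm_swap, hκ.diag, fixClass, pairs_of_lt hI,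
      Finset.prod_insert (notMem_restPairs_left _ _ _), map_mul, permMap_oneSub_rootVec,
      Equiv.swap_apply_left, Equiv.swap_apply_right] at h
    have hrest := (I.comapPerm (Equiv.swap a b)).permMap_prod_fixFactor hab
    rw [comapPerm_swap_comapPerm_swap] at hrest
    rw [hrest] at h
    refine mul_left_cancel₀ hne0 (h.trans ?_)
    rw [fixClass, pairs_of_gt hI', Finset.prod_insert (notMem_restPairs_right _ _ _)]
    simp only [pairCoeff, if_pos hlt, if_neg hlt.not_gt, zratio_sub_hvar]
    rw [← one_sub_zratio a b, ← one_sub_zratio b a]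
    linear_combination (oneSub (LaurentPolynomial.T 1) (rootVec b a) *
      ∏ p ∈ (I.comapPerm (Equiv.swap a b)).restPairs a b,
        oneSub (if p.1 < p.2 then 1 else LaurentPolynomial.T 1) (rootVec p.1 p.2)) *
      zratio_mul_zratio a b
  · intro J hJ
    have hu : SuppIn J.deg 0 (intWidth lam - 1)
        (permMap (Equiv.swap a b) ((J.comapPerm (Equiv.swap a b)).loc κ)) := by
      refine SuppIn.expMap _ ?_
      rw [deg_comp_permExp]
      exact hκ.small _ (hsJ J hJ)
    have hdeg := J.deg_rootVec a b
    have hdeg' := J.deg_rootVec b a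
    rcases le_or_gt (J.block a) (J.block b) with h | h
    · rw [Fin.le_def] at h
      have hpos : 0 ≤ J.deg (rootVec a b) := by omega
      refine SuppIn.of_oneSub_mul one_ne_zero (rootVec_ne_zero hlt.ne) hpos ?_
      rw [hκ' J]
      -- The only term that need not be small is the old diagonal one, of degree up to `W`. There `1
      -- - z_b/z_a` has degree at least one, which absorbs the excess.
      refine SuppIn.sub ?_ (((suppIn_zratio_sub_hvar _ a b hpos).mul hu).mono
        (by omega) (by omega))
      by_cases hJI : J = I
      · subst hJI
        rw [Fin.lt_def] at hI
        rw [hκ.diag]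
        exact ((suppIn_one_sub_hvar _).mul J.suppIn_fixClass).mono (by omega) (by omega)
      · exact ((suppIn_one_sub_hvar _).mul (hκ.small J hJI)).mono (by omega) (by omega)
    · have hJI : J ≠ I := by
        rintro rfl
        exact lt_asymm h hI
      rw [Fin.lt_def] at h
      have hpos : 0 ≤ J.deg (rootVec b a) := by omega
      refine SuppIn.of_oneSub_mul one_ne_zero (rootVec_ne_zero hlt.ne') hpos ?_
      -- Here `z_b/z_a` has negative degree, so the identity is multiplied by `-z_a/z_b`.
      have hrw : oneSub 1 (rootVec b a) * J.loc κ' =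
          oneSub (LaurentPolynomial.T 1) (rootVec b a) *
            permMap (Equiv.swap a b) ((J.comapPerm (Equiv.swap a b)).loc κ) -
          zratio a b * ((1 - hvar n) * J.loc κ) := by
        have h1 := hκ' J
        rw [zratio_sub_hvar, ← one_sub_zratio] at h1
        rw [← one_sub_zratio]
        linear_combination -zratio a b * h1 + (J.loc κ' -
          oneSub (LaurentPolynomial.T 1) (rootVec b a) *
            permMap (Equiv.swap a b) ((J.comapPerm (Equiv.swap a b)).loc κ)) *
          -zratio_mul_zratio a b
      rw [hrw]
      refine SuppIn.sub (((SuppIn.oneSub _ hpos).mul hu).mono (by omega) (by omega)) ?_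
      have h2 : SuppIn J.deg (J.deg (rootVec b a)) (J.deg (rootVec b a)) (zratio a b) :=
        SuppIn.single _ _
      exact (h2.mul ((suppIn_one_sub_hvar _).mul (hκ.small J hJI))).mono (by omega) (by omega)
  · intro J hJ hne
    have hor : J.loc κ ≠ 0 ∨ (J.comapPerm (Equiv.swap a b)).loc κ ≠ 0 := by
      by_contra! hcon
      have h := hκ' J
      rw [hcon.1, hcon.2, map_zero, mul_zero, mul_zero, sub_zero] at h
      exact hne ((mul_eq_zero.1 h).resolve_left hne0)
    rcases hor with h | h
    · by_cases hJI : J = I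
      · rw [hJI]; omega
      · have := hκ.triangular J hJI h
        omega
    · have h1 := hκ.triangular _ (hsJ J hJ) h
      have h2 := J.inv_le_inv_comapPerm_swap hab
      omega

end Existence

/-! ### Weakly increasing partitions, and existence for all partitions. -/

section BaseCase

variable {N n : ℕ} {lam : Fin N → ℕ}

lemma one_sub_inclZ_mul_inclZ (a b : Fin n) :
    1 - inclZ n (mono (-Pi.single a 1)) * inclZ n (var b) = oneSub 1 (rootVec a b) := by
  rw [← map_mul, var, ← mono_add, mono, inclZ_single, map_one, oneSub, rootVec,
    neg_add_eq_sub]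

-- The polynomial `∏ (1 - X/γ)` over the variables in blocks below `k` has `S_λ`-invariant
-- coefficients; the class is its value at `X = z_b`.
open Polynomial in
lemma exists_loc_eq_prod (k : Fin N) (b : Fin n) :
    ∃ κ : KT n lam, ∀ J : FlagIndex n lam,
      J.loc κ = ∏ a ∈ Finset.univ.filter (fun a => J.block a < k), oneSub 1 (rootVec a b) := by
  let F : (Laurent (GammaIdx lam))[X] :=
    ∏ x ∈ Finset.univ.filter (fun x : GammaIdx lam => x.1 < k), (1 - C (mono (-Pi.single x 1)) * X)
  have hF : ∀ r, F.coeff r ∈ invariants (blockPerms lam) := by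
    rintro r _ ⟨e, rfl⟩
    set g := Equiv.Perm.sigmaCongrRightHom (fun i => Fin (lam i)) e
    have hg1 : ∀ x, (g x).1 = x.1 := fun x => rfl
    have h : F.map (rename g : Laurent (GammaIdx lam) →+* Laurent (GammaIdx lam)) = F := by
      simp only [F, Finset.prod_filter, Polynomial.map_prod]
      refine Fintype.prod_equiv g _ _ fun x => ?_
      rw [hg1]
      split_ifs
      · rw [Polynomial.map_sub, Polynomial.map_mul, Polynomial.map_one, map_X, map_C,
          RingHom.coe_coe, rename_mono]
        congr 4
        ext j
        simp [Pi.single_apply, Equiv.symm_apply_eq]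
      · rw [Polynomial.map_one]
    conv_rhs => rw [← h, coeff_map]
    rfl
  refine ⟨∑ r ∈ Finset.range (F.natDegree + 1), KT.tmul ⟨F.coeff r, hF r⟩ (inclZ n (var b) ^ r),
    fun J => ?_⟩
  simp only [map_sum, J.loc_tmul]
  have h := eval₂_eq_sum_range (p := F)
    ((inclZ n).comp (rename J.listing) : Laurent (GammaIdx lam) →+* KPt n) (inclZ n (var b))
  refine h.symm.trans ?_
  simp only [F, eval₂_finsetProd, Finset.prod_filter]
  refine Fintype.prod_equiv J.listing _ _ fun x => ?_
  rw [J.block_listing]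
  split_ifs
  · rw [eval₂_sub, eval₂_one, eval₂_mul, eval₂_C, eval₂_X, ← one_sub_inclZ_mul_inclZ,
      RingHom.coe_coe, AlgHom.comp_apply, rename_mono]
    congr 4
    ext j
    simp [Pi.single_apply, Equiv.symm_apply_eq]
  · exact eval₂_one _ _

/-- The sum of the block numbers depends only on `λ`. -/
lemma FlagIndex.eq_of_block_le (I J : FlagIndex n lam) (h : ∀ a, I.block a ≤ J.block a) :
    J = I := by
  have hsum : ∑ a, ((I.block a : ℕ) : ℤ) = ∑ a, ((J.block a : ℕ) : ℤ) := by
    rw [I.sum_block fun k => ((k : ℕ) : ℤ), J.sum_block fun k => ((k : ℕ) : ℤ)]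
  have hle : ∀ a ∈ Finset.univ, ((I.block a : ℕ) : ℤ) ≤ ((J.block a : ℕ) : ℤ) := fun a _ => by
    exact_mod_cast h a
  refine FlagIndex.block_injective (funext fun a => Fin.ext ?_)
  exact_mod_cast ((Finset.sum_eq_sum_iff_of_le hle).1 hsum a (Finset.mem_univ a)).symm

-- If `J` puts some `a` in an earlier block than `I`, the product contains `1 - z_a/z_a = 0`; this
-- happens for every `J ≠ I`. At `I`, monotonicity makes all pairs horizontal.
open FlagIndex in
lemma exists_isStable_of_monotone (I : FlagIndex n lam) (hI : Monotone I.block) :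
    ∃ κ, IsStable I κ := by
  choose c hc using fun b : Fin n => exists_loc_eq_prod (lam := lam) (I.block b) b
  have hloc : ∀ J : FlagIndex n lam, J.loc (∏ b, c b) =
      ∏ b, ∏ a ∈ Finset.univ.filter (fun a => J.block a < I.block b), oneSub 1 (rootVec a b) :=
    fun J => by
      rw [map_prod]
      exact Finset.prod_congr rfl fun b _ => hc b J
  have hzero : ∀ J : FlagIndex n lam, J ≠ I → J.loc (∏ b, c b) = 0 := by
    intro J hJ
    obtain ⟨a, ha⟩ : ∃ a, J.block a < I.block a := by
      by_contra! h
      exact hJ (I.eq_of_block_le J h)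
    rw [hloc]
    refine Finset.prod_eq_zero (Finset.mem_univ a)
      (Finset.prod_eq_zero (Finset.mem_filter.2 ⟨Finset.mem_univ a, ha⟩) ?_)
    rw [oneSub_eq_zero_iff]
    exact ⟨sub_self _, rfl⟩
  have hdiag : I.loc (∏ b, c b) = I.fixClass := by
    rw [hloc, fixClass, pairs, Finset.prod_filter, Fintype.prod_prod_type_right]
    refine Finset.prod_congr rfl fun b _ => ?_
    rw [Finset.prod_filter]
    refine Finset.prod_congr rfl fun a _ => ?_
    split_ifs with h
    · have hab : a < b := by
        by_contra hab
        exact absurd (hI (not_lt.1 hab)) (not_le.2 h)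
      rw [pairCoeff, if_pos hab]
    · rfl
  refine ⟨∏ b, c b, fun J => ?_, hdiag, fun J hJ => ?_, fun J hJ h => absurd (hzero J hJ) h⟩
  · by_cases hJ : J = I
    · rw [hJ, hdiag, ← horClass_mul_vertClass]
      exact Dvd.intro_left _ rfl
    · rw [hzero J hJ]
      exact dvd_zero _
  · rw [hzero J hJ]
    exact SuppIn.zero

lemma exists_descent_of_not_monotone {f : Fin n → Fin N} (hf : ¬ Monotone f) :
    ∃ a b : Fin n, (b : ℕ) = a + 1 ∧ f b < f a := by
  obtain _ | n := n
  · exact absurd (fun a => a.elim0) hf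
  · rw [Fin.monotone_iff_le_succ] at hf
    push Not at hf
    obtain ⟨i, hi⟩ := hf
    exact ⟨i.castSucc, i.succ, by simp, hi⟩

lemma exists_isStable (I : FlagIndex n lam) : ∃ κ, IsStable I κ := by
  induction h : I.inv generalizing I with
  | zero =>
    refine exists_isStable_of_monotone I ?_
    by_contra hI
    obtain ⟨a, b, hab, hlt⟩ := exists_descent_of_not_monotone hI
    have := (I.comapPerm (Equiv.swap a b)).inv_comapPerm_swap_of_lt hab (by simpa using hlt)
    rw [I.comapPerm_swap_comapPerm_swap] at this
    omega
  | succ m ih =>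
    by_cases hI : Monotone I.block
    · exact exists_isStable_of_monotone I hI
    · obtain ⟨a, b, hab, hlt⟩ := exists_descent_of_not_monotone hI
      have hlt' : (I.comapPerm (Equiv.swap a b)).block a <
          (I.comapPerm (Equiv.swap a b)).block b := by simpa using hlt
      have := (I.comapPerm (Equiv.swap a b)).inv_comapPerm_swap_of_lt hab hlt'
      rw [I.comapPerm_swap_comapPerm_swap] at this
      obtain ⟨κ, hκ⟩ := ih (I.comapPerm (Equiv.swap a b)) (by omega)
      have h2 := hκ.exists_swap hab hlt'
      rwa [I.comapPerm_swap_comapPerm_swap] at h2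

end BaseCase

end EquivK

end

/-! ### Transport from the identity to `σ`. -/

theorem theorem3p1 (N n : ℕ) (lam : Fin N → ℕ) (hlam : ∑ i, lam i = n)
    (σ : Equiv.Perm (Fin n)) (I : EquivK.FlagIndex n lam) :
    ∃! κ : EquivK.KT n lam,
      (∀ J : EquivK.FlagIndex n lam, EquivK.eVertMinus σ J ∣ J.loc κ) ∧
      I.loc κ = EquivK.polarization σ I * EquivK.eClass σ I ∧
      (∀ J : EquivK.FlagIndex n lam, J ≠ I → EquivK.IsSmall J (J.loc κ)) := by
  open EquivK in
  obtain ⟨κ₀, h₀⟩ := exists_isStable (I.comapPerm σ)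
  obtain ⟨κ, hκ⟩ := exists_loc_eq_permMap σ κ₀
  have hvert : ∀ J : FlagIndex n lam, eVertMinus σ J ∣ J.loc κ := fun J => by
    rw [hκ, eVertMinus_eq]
    exact map_dvd _ (h₀.vert _)
  have hdiag : I.loc κ = polarization σ I * eClass σ I := by
    rw [hκ, polarization_mul_eClass, h₀.diag]
  have hsmall : ∀ J : FlagIndex n lam, J ≠ I → IsSmall J (J.loc κ) := fun J hJ => by
    rw [hκ, isSmall_permMap_iff]
    exact h₀.small _ fun h => hJ (FlagIndex.comapPerm_injective σ h)
  refine ⟨κ, ⟨hvert, hdiag, hsmall⟩, fun κ' ⟨hvert', hdiag', hsmall'⟩ => ?_⟩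
  -- The difference is pulled back by `σ`, so that the vanishing statement for the identity chamber
  -- applies.
  obtain ⟨δ, hδ⟩ := exists_loc_eq_permMap σ.symm (κ' - κ)
  have hδσ : ∀ J : FlagIndex n lam,
      permMap σ ((J.comapPerm σ).loc δ) = J.loc κ' - J.loc κ := fun J => by
    rw [hδ, permMap_permMap_symm, J.comapPerm_comapPerm_symm, map_sub]
  have hδ0 : ∀ J : FlagIndex n lam, J.loc δ = 0 := by
    have hex : ∀ J : FlagIndex n lam, ∃ K : FlagIndex n lam, K.comapPerm σ = J := fun J =>
      ⟨J.comapPerm σ.symm, J.comapPerm_symm_comapPerm σ⟩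
    refine loc_eq_zero_of_small (I.comapPerm σ) δ ?_ ?_ ?_
    · apply permMap_injective σ
      rw [hδσ, hdiag, hdiag', sub_self, map_zero]
    · intro J
      obtain ⟨K, rfl⟩ := hex J
      obtain ⟨g, hg⟩ : permMap σ (K.comapPerm σ).vertClass ∣ permMap σ ((K.comapPerm σ).loc δ) := by
        rw [hδσ, ← eVertMinus_eq]
        exact dvd_sub (hvert' K) (hvert K)
      refine ⟨permMap σ.symm g, permMap_injective σ ?_⟩
      rw [hg, map_mul, permMap_permMap_symm]
    · intro J hJ
      obtain ⟨K, rfl⟩ := hex J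
      have hK : K ≠ I := fun h => hJ (by rw [h])
      rw [← isSmall_permMap_iff, hδσ, isSmall_iff]
      exact ((isSmall_iff _ _).1 (hsmall' K hK)).sub ((isSmall_iff _ _).1 (hsmall K hK))
  refine eq_of_loc_eq I.listing.symm _ _ fun J => ?_
  rw [← sub_eq_zero, ← hδσ, hδ0, map_zero]
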